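/- **Setting.** Let $\alpha\in(1,2)$, $c>0$, and let $\xi$ be a critical offspring distribution on $\{0,1,2,\dots\}$, i.e. $\sum_k k\,\xi(k)=1$, with $$\xi(k)\sim c\,k^{-\alpha-1}\qquad (k\to\infty).$$ *Inserted graphs.* For each $n\ge1$ let $(G_n,d_n,\ell_n)$ be a random almost surely connected finite simple graph $G_n$ with $n$ distinguished boundary vertices $\partial G_n$, a bijective labelling $\ell_n:\partial G_n\to\{0,\dots,n-1\}$ and a metric $d_n$ on its vertices; $V_n$ is the measure $V_n(x)=\deg x$ on $G_n$. Write $\mathrm{Diam}(G_n)=\max_{x,y}d_n(x,y)$; let $R_{\mathrm{eff}}$ be the effective resistance on $G_n$ with unit conductances, i.e. $R_{\mathrm{eff}}(a,b)^{-1}=\inf\{\tfrac12\sum_{x\sim y}(f(x)-f(y))^2: f(a)=1,f(b)=0\}$ (the sum is over ordered pairs) for $a\neq b$ and $R_{\mathrm{eff}}(a,a)=0$; and let $\mathrm{Diam}_{\mathrm{res}}(G_n)=\max_{x,y}R_{\mathrm{eff}}(x,y)$. For $n\ge2$ let $(U^{(1)}_n,U^{(2)}_n)$ be a uniform pair of distinct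 boundary vertices, $d_n^U=d_n(U_n^{(1)},U_n^{(2)})$ and $R_n^U=R_{\mathrm{eff}}(U_n^{(1)},U_n^{(2)})$. *Assumption 1.* * (D) There are $d\ge1$, $\epsilon>0$ with $\inf_{n\ge2}P(d_n^U\ge n^{1/d})>0$ and $\sup_{n\ge1}P(\mathrm{Diam}(G_n)\ge\lambda n^{1/d})=O(\lambda^{-\frac{\alpha+\epsilon}{\alpha-1}})$ as $\lambda\to\infty$. * (R) There are $R\ge1$, $\epsilon>0$ with $\inf_{n\ge2}P(R_n^U\ge n^{1/R})>0$ and $\sup_{n\ge1}P(\mathrm{Diam}_{\mathrm{res}}(G_n)\ge\lambda n^{1/R})=O(\lambda^{-\frac{\alpha+\epsilon}{\alpha-1}})$ as $\lambda\to\infty$. * (V) There are $v\ge1$, $\epsilon>0$ with $\inf_{n\ge1}P(V_n(G_n)\ge n^{v})>0$ and $\sup_{n\ge1}P(V_n(G_n)\ge\lambda n^{v})=O(\lambda^{-\frac{\alpha+\epsilon}{v}})$ as $\lambda\to\infty$. *Kesten's tree.* $T_\infty$ is the random plane tree whose individuals are normal or special: the root $\rho$ is special; a normal individual has a number of children of law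 $\xi$, all normal; a special individual has a number of children of law $\xi^*(k)=k\,\xi(k)$, one of which, chosen uniformly, is special, the others being normal; all choices are independent. It is planted: a vertex $\mathrm{par}(\rho)$ (the seed) is joined to $\rho$ by the root edge. Thus $\deg u$ is the number of children of $u$ plus one. *Decorated Kesten tree.* Given $T_\infty$, take independently for each $u\in T_\infty$ other than the seed a copy $(G(u),d(u),\ell(u))$ of $(G_{\deg u},d_{\deg u},\ell_{\deg u})$ and a uniform $U_u\in\{0,\dots,\deg u-1\}$. The boundary vertex $x\in\partial G(u)$ is matched with the edge from $u$ to its parent if $\ell(u)(x)+U_u\equiv0\pmod{\deg u}$, and with the edge from $u$ to its $j$-th child if $\ell(u)(x)+U_u\equiv j \pmod{\deg u}$, $1\le j\le\deg u-1$. Boundary vertices matched with the same edge are identified, and a new vertex $\rho^{\mathrm{dec}}$ is joined by one edge to the vertex of $G(\rho)$ matched with the root edge. The resulting graph, rooted at $\rho^{\mathrm{dec}}$, is $\mathcal T_\infty^{\mathrm{dec}}$; let $\mathbf P$ be the law of all this randomness. **Theorem.** If $\xi$ is as above and Assumption 1 holds, then for $\mathbf P$-almost every realization of $\mathcal T_\infty^{\mathrm{dec}}$,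 simple random walk on $\mathcal T_\infty^{\mathrm{dec}}$ (which from $x$ jumps to each neighbour of $x$ with probability $1/\deg x$) is recurrent: started from any vertex $x$, in particular from $\rho^{\mathrm{dec}}$, it almost surely returns to $x$ infinitely often. -/

import Mathlib

open MeasureTheory ProbabilityTheory Filter Asymptotics
open scoped ENNReal

/-! ### The inserted graphs -/

/-- A finite simple graph on the vertex set `Fin N` with `n` distinguished, labelled boundary
vertices and a metric on its vertices.  `bdry i` is the boundary vertex with label `i`, that is,
`bdry` is the inverse of the labelling `ℓ : ∂G → {0, …, n - 1}`. -/
structure InsertedGraph (n : ℕ) where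
  N : ℕ
  graph : SimpleGraph (Fin N)
  bdry : Fin n ↪ Fin N
  metric : MetricSpace (Fin N)

namespace InsertedGraph

variable {n : ℕ}

/-- The combinatorial part (graph and labelled boundary), an element of a countable set. -/
def shape (X : InsertedGraph n) : Σ N : ℕ, SimpleGraph (Fin N) × (Fin n ↪ Fin N) :=
  ⟨X.N, X.graph, X.bdry⟩

/-- The distance between two vertices given by their numbers (`0` if there is no such vertex). -/
def distAt (i j : ℕ) (X : InsertedGraph n) : ℝ :=
  if h : i < X.N ∧ j < X.N then X.metric.dist ⟨i, h.1⟩ ⟨j, h.2⟩ else 0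

/-- The σ-algebra: discrete in the combinatorial part, Borel in the distances. -/
instance : MeasurableSpace (InsertedGraph n) :=
  MeasurableSpace.comap shape ⊤ ⊔
    ⨆ i : ℕ, ⨆ j : ℕ, MeasurableSpace.comap (distAt i j) (borel ℝ)

/-- The diameter for the given metric. -/
noncomputable def diam (X : InsertedGraph n) : ℝ :=
  ⨆ p : Fin X.N × Fin X.N, X.metric.dist p.1 p.2

open Classical in
/-- The Dirichlet energy `½ ∑_{p ∼ q} (f p - f q)²`. -/
noncomputable def energy (X : InsertedGraph n) (f : Fin X.N → ℝ) : ℝ :=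
  (1 / 2) * ∑ p, ∑ q, if X.graph.Adj p q then (f p - f q) ^ 2 else 0

/-- The effective resistance between two vertices when every edge has conductance `1`
(it is `0` if `a = b`). -/
noncomputable def effRes (X : InsertedGraph n) (a b : Fin X.N) : ℝ≥0∞ :=
  (⨅ f : Fin X.N → ℝ, ⨅ _ : f a = 1 ∧ f b = 0, ENNReal.ofReal (X.energy f))⁻¹

/-- The diameter for the effective resistance. -/
noncomputable def resDiam (X : InsertedGraph n) : ℝ≥0∞ :=
  ⨆ a, ⨆ b, X.effRes a b

/-- The total mass of the measure that gives every vertex its degree. -/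
noncomputable def volume (X : InsertedGraph n) : ℕ :=
  ∑ p, (X.graph.neighborSet p).ncard

end InsertedGraph

/-- The law of a uniform pair of distinct labels in `{0, …, n - 1}`, for `2 ≤ n`. -/
noncomputable def uniformPair (n : ℕ) : Measure (Fin n × Fin n) :=
  uniformOn {p | p.1 ≠ p.2}

/-- The growth assumptions (metric, resistance, volume) on the laws `μ n` of the inserted graphs
with `n` boundary vertices.  A uniform pair of distinct boundary vertices exists only if `2 ≤ n`,
so the lower bounds on two-point distances are about such `n`. -/
structure GrowthAssumption (α : ℝ) (μ : ∀ n, Measure (InsertedGraph n)) : Prop where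
  metric_growth : ∃ d : ℝ, 1 ≤ d ∧ ∃ ε : ℝ, 0 < ε ∧
    (0 < ⨅ n : ℕ, ⨅ _ : 2 ≤ n, ((μ n).prod (uniformPair n))
      {q | (n : ℝ) ^ (1 / d) ≤ q.1.metric.dist (q.1.bdry q.2.1) (q.1.bdry q.2.2)}) ∧
    (fun t : ℝ => (⨆ n : ℕ, ⨆ _ : 1 ≤ n, μ n {X | t * (n : ℝ) ^ (1 / d) ≤ X.diam}).toReal)
      =O[atTop] fun t : ℝ => t ^ (-((α + ε) / (α - 1)))
  resistance_growth : ∃ R : ℝ, 1 ≤ R ∧ ∃ ε : ℝ, 0 < ε ∧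
    (0 < ⨅ n : ℕ, ⨅ _ : 2 ≤ n, ((μ n).prod (uniformPair n))
      {q | ENNReal.ofReal ((n : ℝ) ^ (1 / R)) ≤ q.1.effRes (q.1.bdry q.2.1) (q.1.bdry q.2.2)}) ∧
    (fun t : ℝ => (⨆ n : ℕ, ⨆ _ : 1 ≤ n,
        μ n {X | ENNReal.ofReal (t * (n : ℝ) ^ (1 / R)) ≤ X.resDiam}).toReal)
      =O[atTop] fun t : ℝ => t ^ (-((α + ε) / (α - 1)))
  volume_growth : ∃ v : ℝ, 1 ≤ v ∧ ∃ ε : ℝ, 0 < ε ∧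
    (0 < ⨅ n : ℕ, ⨅ _ : 1 ≤ n, μ n {X | (n : ℝ) ^ v ≤ (X.volume : ℝ)}) ∧
    (fun t : ℝ => (⨆ n : ℕ, ⨆ _ : 1 ≤ n, μ n {X | t * (n : ℝ) ^ v ≤ (X.volume : ℝ)}).toReal)
      =O[atTop] fun t : ℝ => t ^ (-((α + ε) / v))

/-! ### The randomness -/

/-- The size-biased version `ξ*(k) = k ξ(k)` of a critical offspring distribution. -/
noncomputable def sizeBiased (ξ : PMF ℕ) (hξ : ∑' k : ℕ, (k : ℝ≥0∞) * ξ k = 1) : PMF ℕ :=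
  ⟨fun k => (k : ℝ≥0∞) * ξ k, hξ ▸ ENNReal.summable.hasSum⟩

/-- The random data attached to an individual:
* its number of children if it is normal;
* its number of children if it is special;
* for every `m`, the special child among `m + 1` children;
* for every `k`, the graph that is inserted if it has `k` children (degree `k + 1`);
* for every `k`, the rotation of the boundary labels if it has `k` children. -/
abbrev Seed : Type :=
  ℕ × ℕ × (∀ m : ℕ, Fin (m + 1)) × (∀ k : ℕ, InsertedGraph (k + 1)) × (∀ k : ℕ, Fin (k + 1))

/-- The law of the data of one individual: the components are independent. -/
noncomputable def seedLaw (ξ : PMF ℕ) (hξ : ∑' k : ℕ, (k : ℝ≥0∞) * ξ k = 1)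
    (μ : ∀ n, Measure (InsertedGraph n)) [∀ n, IsProbabilityMeasure (μ n)] : Measure Seed :=
  ξ.toMeasure.prod <| (sizeBiased ξ hξ).toMeasure.prod <|
    (Measure.infinitePi fun m : ℕ => uniformOn (Set.univ : Set (Fin (m + 1)))).prod <|
      (Measure.infinitePi fun k : ℕ => μ (k + 1)).prod <|
        Measure.infinitePi fun k : ℕ => uniformOn (Set.univ : Set (Fin (k + 1)))

instance (ξ : PMF ℕ) (hξ : ∑' k : ℕ, (k : ℝ≥0∞) * ξ k = 1)
    (μ : ∀ n, Measure (InsertedGraph n)) [∀ n, IsProbabilityMeasure (μ n)] :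
    IsProbabilityMeasure (seedLaw ξ hξ μ) := by
  unfold seedLaw; infer_instance

/-- The law `𝐏` of the whole environment: the data of the possible individuals are i.i.d.
Individuals are Ulam–Harris words, written backwards: the word `j :: u` is the child number `j`
(counted from `0`) of `u`, and `[]` is the root. -/
noncomputable def environmentLaw (ξ : PMF ℕ) (hξ : ∑' k : ℕ, (k : ℝ≥0∞) * ξ k = 1)
    (μ : ∀ n, Measure (InsertedGraph n)) [∀ n, IsProbabilityMeasure (μ n)] :
    Measure (List ℕ → Seed) :=
  Measure.infinitePi fun _ => seedLaw ξ hξ μ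

/-! ### Kesten's tree and its decoration -/

namespace DecoratedKesten

variable (ω : List ℕ → Seed)

/-- The number of the special child of `u`, if `u` is special. -/
def heir (u : List ℕ) : ℕ := (ω u).2.2.1 ((ω u).2.1 - 1)

/-- The root is special; any other individual is special if it is the special child of a
special individual. -/
def IsSpecial : List ℕ → Prop
  | [] => True
  | j :: u => IsSpecial u ∧ j = heir ω u

open Classical in
/-- The number of children. -/
noncomputable def numChildren (u : List ℕ) : ℕ :=
  if IsSpecial ω u then (ω u).2.1 else (ω u).1

/-- Membership in Kesten's tree `T_∞`. -/
def InTree : List ℕ → Prop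
  | [] => True
  | j :: u => InTree u ∧ j < numChildren ω u

/-- The graph `G(u)`; its boundary size is the degree of `u` in the planted tree. -/
noncomputable def graphAt (u : List ℕ) : InsertedGraph (numChildren ω u + 1) :=
  (ω u).2.2.2.1 (numChildren ω u)

/-- The rotation `U_u`, uniform on `{0, …, deg u - 1}`. -/
noncomputable def rotation (u : List ℕ) : Fin (numChildren ω u + 1) :=
  (ω u).2.2.2.2 (numChildren ω u)

/-- The edges of the planted tree at `u`, an edge being named by its endpoint further from the
seed: edge `0` leads to the parent (to the seed if `u` is the root), edge `j + 1` leads to the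
child number `j` (counted from `0`). -/
def edgeAt (u : List ℕ) {k : ℕ} : Fin (k + 1) → List ℕ :=
  Fin.cases u fun j : Fin k => (j : ℕ) :: u

/-- The disjoint union of the vertex sets of the graphs `G(u)`, `u ∈ T_∞`. -/
abbrev PreVertex : Type := Σ u : {u : List ℕ // InTree ω u}, Fin (graphAt ω u).N

/-- `x ∈ G(u)` is the boundary vertex in bijection with the edge `e`, that is, `x` has the label
`i`, and `e` is the edge of `u` with number `i + U_u` modulo `deg u`. -/
def Attached (x : PreVertex ω) (e : List ℕ) : Prop :=
  ∃ i, (graphAt ω x.1).bdry i = x.2 ∧ edgeAt x.1 (i + rotation ω x.1) = e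

/-- Two different vertices are identified if they are boundary vertices in bijection with the same
edge. -/
def glue : Setoid (PreVertex ω) where
  r x y := x = y ∨ ∃ e, Attached ω x e ∧ Attached ω y e
  iseqv :=
    { refl := fun _ => Or.inl rfl
      symm := by
        rintro x y (h | ⟨e, hx, hy⟩)
        · exact Or.inl h.symm
        · exact Or.inr ⟨e, hy, hx⟩
      trans := by
        rintro x y z (rfl | ⟨e, hx, i, hi, rfl⟩) (rfl | ⟨e', ⟨i', hi', rfl⟩, hz⟩)
        · exact Or.inl rfl
        · exact Or.inr ⟨_, ⟨i', hi', rfl⟩, hz⟩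
        · exact Or.inr ⟨_, hx, i, hi, rfl⟩
        · obtain rfl : i = i' := (graphAt ω y.1).bdry.injective (hi.trans hi'.symm)
          exact Or.inr ⟨_, hx, hz⟩ }

/-- The vertices of the decorated tree; `none` is the added root `ρ^dec`. -/
def Vertex : Type := Option (Quotient (glue ω))

instance : MeasurableSpace (Vertex ω) := ⊤

instance : DiscreteMeasurableSpace (Vertex ω) := ⟨fun _ => trivial⟩

/-- The edges of the decorated tree: those of the graphs `G(u)`, and the edge from the added root
to the boundary vertex of `G([])` that belongs to the root edge of the planted tree. -/
inductive EdgeRel : Vertex ω → Vertex ω → Prop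
  | inner (u : {u : List ℕ // InTree ω u}) (p q : Fin (graphAt ω u).N)
      (h : (graphAt ω u).graph.Adj p q) :
      EdgeRel (some (Quotient.mk (glue ω) ⟨u, p⟩)) (some (Quotient.mk (glue ω) ⟨u, q⟩))
  | root (x : PreVertex ω) (h : Attached ω x []) :
      EdgeRel none (some (Quotient.mk (glue ω) x))

/-- The decorated Kesten tree `T_∞^dec`. -/
def tree : SimpleGraph (Vertex ω) := SimpleGraph.fromRel (EdgeRel ω)

end DecoratedKesten

/-! ### Simple random walk -/

section SimpleRandomWalk

variable {V : Type*} [MeasurableSpace V]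

open Classical in
/-- One step of simple random walk from `x`: uniform on the neighbours of `x`.  (A vertex without
neighbours or with infinitely many is made absorbing, so that the step has a law.) -/
noncomputable def srwStep (G : SimpleGraph V) (x : V) : Measure V :=
  if (G.neighborSet x).Finite ∧ (G.neighborSet x).Nonempty then uniformOn (G.neighborSet x)
  else Measure.dirac x

variable [DiscreteMeasurableSpace V]

/-- The transition kernel of simple random walk. -/
noncomputable def srwKernel (G : SimpleGraph V) : Kernel V V := ⟨srwStep G, .of_discrete⟩

instance (G : SimpleGraph V) : IsMarkovKernel (srwKernel G) := by
  refine ⟨fun x => ?_⟩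
  change IsProbabilityMeasure (srwStep G x)
  unfold srwStep
  split_ifs with h
  · exact isProbabilityMeasure_uniformOn h.1 h.2
  · infer_instance

/-- The law of simple random walk `(X_n)_{n ≥ 0}` with `X_0 = x`. -/
noncomputable def srwLaw (G : SimpleGraph V) (x : V) : Measure (ℕ → V) :=
  Kernel.traj (X := fun _ => V)
    (fun n => (srwKernel G).comap (fun h : Finset.Iic n → V => h ⟨n, Finset.mem_Iic.2 le_rfl⟩)
      (measurable_pi_apply _)) 0 (fun _ => x)

/-- Simple random walk is recurrent: from every vertex `x` it almost surely returns to `x`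
infinitely often. -/
def SRWRecurrent (G : SimpleGraph V) : Prop :=
  ∀ x, ∀ᵐ X ∂(srwLaw G x), ∃ᶠ n in atTop, X n = x

end SimpleRandomWalk

/-! The special individuals form a single ray, the spine, and everything that hangs off it is a
critical Galton–Watson tree, hence almost surely finite. A path to infinity must cross every graph
`G(s)` on the spine, from the vertex matched with the parent edge to the vertex matched with the
edge to the heir. The seeds along the spine are i.i.d., and with positive probability these two
vertices have effective resistance at least 1: by the lower bound in (R) some pair of labels has
this property with positive probability at a fixed degree `k + 1` with `ξ k ≠ 0`, and size-biasing,
the choice of the heir and the rotation select that pair with positive probability. So infinitely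
many unit resistances lie in series (`ae_frequently_spine`, `exists_resistive_event`).

In terms of energy (`hasCutoffs_tree`), the potentials of `L` such graphs, extended by constants to
the rest of the tree, have gradients with disjoint supports. Their average is 1 on any prescribed
edge if the graphs are far enough out, has finite support, and has energy of order `1 / L`.

Such cutoffs give recurrence (`SimpleGraph.HasCutoffs.srwRecurrent`): the probability `h` of never
hitting `x` is bounded, vanishes at `x` and is harmonic elsewhere. Testing `h Δh = 0` against
squared cutoffs makes `h` constant along edges, so `h(X_n)` has mean `h(x) = 0` for every `n`, and
the walk visits `x` after every time `n`. -/

/-! ### Recurrence from cutoffs of small energy -/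

section RecurrenceCriterion

variable {V : Type*}

open Classical in
/-- The Dirichlet energy of `f`, restricted to the edges inside the finite set `W`; every edge is
counted twice. -/
noncomputable def SimpleGraph.energyOn (G : SimpleGraph V) (W : Finset V) (f : V → ℝ) : ℝ :=
  ∑ a ∈ W, ∑ b ∈ W, if G.Adj a b then (f a - f b) ^ 2 else 0

/-- Every edge lies in a region where some finitely supported function of small energy equals
`1`. -/
def SimpleGraph.HasCutoffs (G : SimpleGraph V) : Prop :=
  ∀ p q, G.Adj p q → ∀ ε : ℝ, 0 < ε → ∃ (W : Finset V) (f : V → ℝ),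
    (∀ a b, G.Adj a b → f a ≠ 0 → b ∈ W) ∧ f p = 1 ∧ f q = 1 ∧ G.energyOn W f ≤ ε

open Classical in
/-- Caccioppoli's inequality: a bounded nonnegative function that is harmonic where it does not
vanish is controlled by the energy of a cutoff function. -/
theorem SimpleGraph.energyOn_mul_le (G : SimpleGraph V) (W : Finset V) (f g : V → ℝ)
    (hW : ∀ a b, G.Adj a b → f a ≠ 0 → b ∈ W) (hg0 : ∀ a, 0 ≤ g a) (hg1 : ∀ a, g a ≤ 1)
    (hg : ∀ (a) (S : Finset V), (∀ b, G.Adj a b → b ∈ S) →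
      g a * ∑ b ∈ S, (if G.Adj a b then g a - g b else 0) = 0) :
    G.energyOn W (fun a => f a * g a) ≤ G.energyOn W f := by
  have key : ∑ a ∈ W, ∑ b ∈ W,
      (if G.Adj a b then f a ^ 2 * g a * (g a - g b) else 0) = 0 := by
    refine Finset.sum_eq_zero fun a _ => ?_
    by_cases hfa : f a = 0
    · simp [hfa]
    -- Where `f a ≠ 0`, all neighbours of `a` lie in `W`, so the inner sum is the full Laplacian of
    -- `g` at `a`.
    · have := hg a W fun b hb => hW a b hb hfa
      calc _ = f a ^ 2 * (g a * ∑ b ∈ W, (if G.Adj a b then g a - g b else 0)) := by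
            rw [Finset.mul_sum, Finset.mul_sum]
            refine Finset.sum_congr rfl fun b _ => ?_
            split_ifs <;> ring
        _ = 0 := by rw [this, mul_zero]
  have key' : ∑ a ∈ W, ∑ b ∈ W,
      (if G.Adj a b then f b ^ 2 * g b * (g b - g a) else 0) = 0 := by
    rw [Finset.sum_comm]
    refine Eq.trans ?_ key
    refine Finset.sum_congr rfl fun a _ => Finset.sum_congr rfl fun b _ => ?_
    simp only [G.adj_comm]
  -- `(f a g a - f b g b)² = g a g b (f a - f b)² + f a² g a (g a - g b) + f b² g b (g b - g a)`;
  -- the last two terms sum to zero.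
  have expand : G.energyOn W (fun a => f a * g a) =
      ∑ a ∈ W, ∑ b ∈ W, (if G.Adj a b then g a * g b * (f a - f b) ^ 2 else 0) := by
    refine Eq.trans ?_ ((congrArg₂ (_ + · + ·) key key').trans (by rw [add_zero, add_zero]))
    simp only [energyOn, ← Finset.sum_add_distrib]
    refine Finset.sum_congr rfl fun a _ => Finset.sum_congr rfl fun b _ => ?_
    split_ifs <;> ring
  rw [expand, energyOn]
  refine Finset.sum_le_sum fun a _ => Finset.sum_le_sum fun b _ => ?_
  split_ifs
  · exact mul_le_of_le_one_left (sq_nonneg _) (mul_le_one₀ (hg1 a) (hg0 b) (hg1 b))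
  · exact le_rfl

open Classical in
/-- In the presence of cutoffs, a bounded nonnegative function that is harmonic where it does not
vanish is locally constant. -/
theorem SimpleGraph.HasCutoffs.eq_of_adj {G : SimpleGraph V} (hG : G.HasCutoffs) {g : V → ℝ}
    (hg0 : ∀ a, 0 ≤ g a) (hg1 : ∀ a, g a ≤ 1)
    (hg : ∀ (a) (S : Finset V), (∀ b, G.Adj a b → b ∈ S) →
      g a * ∑ b ∈ S, (if G.Adj a b then g a - g b else 0) = 0)
    {p q : V} (hpq : G.Adj p q) : g p = g q := by
  have h : ∀ ε : ℝ, 0 < ε → (g p - g q) ^ 2 ≤ ε := by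
    intro ε hε
    obtain ⟨W, f, hW, hp, hq, hE⟩ := hG p q hpq ε hε
    -- Since `f p = f q = 1`, the edge `pq` alone contributes `(g p - g q)²` to the energy of `f g`.
    refine le_trans ?_ ((G.energyOn_mul_le W f g hW hg0 hg1 hg).trans hE)
    have hpW : p ∈ W := hW q p hpq.symm (by simp [hq])
    have hqW : q ∈ W := hW p q hpq (by simp [hp])
    have nonneg : ∀ a b : V, 0 ≤ if G.Adj a b then (f a * g a - f b * g b) ^ 2 else (0 : ℝ) :=
      fun a b => by split_ifs <;> positivity
    calc (g p - g q) ^ 2 = if G.Adj p q then (f p * g p - f q * g q) ^ 2 else (0 : ℝ) := by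
          simp [hpq, hp, hq]
      _ ≤ ∑ b ∈ W, if G.Adj p b then (f p * g p - f b * g b) ^ 2 else (0 : ℝ) :=
          Finset.single_le_sum
            (f := fun b => if G.Adj p b then (f p * g p - f b * g b) ^ 2 else (0 : ℝ))
            (fun b _ => nonneg p b) hqW
      _ ≤ _ := Finset.single_le_sum
            (f := fun a => ∑ b ∈ W, if G.Adj a b then (f a * g a - f b * g b) ^ 2 else (0 : ℝ))
            (fun a _ => Finset.sum_nonneg fun b _ => nonneg a b) hpW
  have := le_of_forall_pos_le_add (a := (g p - g q) ^ 2) (b := 0) fun ε hε => by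
    simpa using h ε hε
  exact sub_eq_zero.1 (pow_eq_zero_iff two_ne_zero |>.1 (le_antisymm this (sq_nonneg _)))

theorem SimpleGraph.HasCutoffs.finite_neighborSet {G : SimpleGraph V} (hG : G.HasCutoffs) (p : V) :
    (G.neighborSet p).Finite := by
  by_cases h : ∃ q, G.Adj p q
  · obtain ⟨q, hq⟩ := h
    obtain ⟨W, f, hW, hp, -⟩ := hG p q hq 1 one_pos
    exact W.finite_toSet.subset fun b hb => hW p b hb (by simp [hp])
  · push Not at h
    exact Set.finite_empty.subset fun b hb => (h b hb).elim

variable [MeasurableSpace V]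

open Classical in
/-- The probability that simple random walk from `y` avoids `x` at the times `0, …, m - 1`. -/
noncomputable def avoidProb (G : SimpleGraph V) (x : V) : ℕ → V → ℝ≥0∞
  | 0, _ => 1
  | m + 1, y => if y = x then 0 else ∫⁻ z, avoidProb G x m z ∂(srwStep G y)

/-- The probability that simple random walk from `y` never visits `x`. -/
noncomputable def escapeProb (G : SimpleGraph V) (x y : V) : ℝ≥0∞ := ⨅ m, avoidProb G x m y

theorem escapeProb_self (G : SimpleGraph V) (x : V) : escapeProb G x x = 0 :=
  le_antisymm ((iInf_le _ 1).trans (by simp [avoidProb])) zero_le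

variable [DiscreteMeasurableSpace V]

theorem lintegral_uniformOn_coe (S : Finset V) (φ : V → ℝ≥0∞) :
    ∫⁻ y, φ y ∂(uniformOn (S : Set V)) = (S.card : ℝ≥0∞)⁻¹ * ∑ y ∈ S, φ y := by
  rw [uniformOn, ProbabilityTheory.cond, lintegral_smul_measure, lintegral_finset]
  simp

instance (G : SimpleGraph V) (x : V) : IsProbabilityMeasure (srwStep G x) :=
  inferInstanceAs (IsProbabilityMeasure (srwKernel G x))

instance (G : SimpleGraph V) (x : V) : IsProbabilityMeasure (srwLaw G x) := by
  unfold srwLaw; infer_instance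

/-- The Markov property of simple random walk at a fixed time. -/
theorem lintegral_srwLaw_succ (G : SimpleGraph V) (x : V) (n : ℕ)
    {F : (Finset.Iic n → V) → ℝ≥0∞} (hF : Measurable F) (φ : V → ℝ≥0∞) :
    ∫⁻ X, F (Preorder.frestrictLe n X) * φ (X (n + 1)) ∂(srwLaw G x) =
      ∫⁻ X, F (Preorder.frestrictLe n X) * (∫⁻ y, φ y ∂(srwStep G (X n))) ∂(srwLaw G x) := by
  set κ : ∀ n : ℕ, Kernel (∀ _ : Finset.Iic n, V) V := fun n =>
    (srwKernel G).comap (fun h : Finset.Iic n → V => h ⟨n, Finset.mem_Iic.2 le_rfl⟩)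
      (measurable_pi_apply _) with hκ
  have hφ : Measurable φ := .of_discrete
  have h := Kernel.partialTraj_compProd_eq_map_traj (X := fun _ => V) (κ := κ) (Nat.zero_le n)
    (x₀ := fun _ => x)
  have hlaw : srwLaw G x = Kernel.traj (X := fun _ => V) κ 0 (fun _ => x) := rfl
  rw [hlaw]
  have e1 := lintegral_map (μ := Kernel.traj (X := fun _ => V) κ 0 (fun _ => x))
    (f := fun p : (Finset.Iic n → V) × V => F p.1 * φ p.2)
    (g := fun X => (Preorder.frestrictLe n X, X (n + 1))) (by fun_prop) (by fun_prop)
  refine e1.symm.trans ?_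
  rw [← h, Measure.lintegral_compProd (by fun_prop), ← Kernel.traj_map_frestrictLe_apply,
    lintegral_map (Measurable.lintegral_kernel_prod_right'
      (f := fun p : (Finset.Iic n → V) × V => F p.1 * φ p.2) (by fun_prop)) (by fun_prop)]
  refine lintegral_congr fun X => ?_
  exact lintegral_const_mul (μ := srwStep G (X n)) (F (Preorder.frestrictLe n X)) hφ

theorem avoidProb_le_one (G : SimpleGraph V) (x : V) (m : ℕ) (y : V) : avoidProb G x m y ≤ 1 := by
  induction m generalizing y with
  | zero => exact le_rfl
  | succ m ih =>
    rw [avoidProb]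
    split_ifs
    · exact zero_le
    · exact (lintegral_mono fun z => ih z).trans (by simp)

theorem antitone_avoidProb (G : SimpleGraph V) (x : V) : Antitone (avoidProb G x) := by
  refine antitone_nat_of_succ_le fun m => ?_
  induction m with
  | zero => exact fun y => avoidProb_le_one G x 1 y
  | succ m ih =>
    intro y
    rw [avoidProb, avoidProb]
    split_ifs
    · exact le_rfl
    · exact lintegral_mono ih

theorem measure_forall_ne_eq (G : SimpleGraph V) (x₀ x : V) (n m : ℕ) :
    srwLaw G x₀ {X | ∀ j, n ≤ j → j < n + m → X j ≠ x} =
      ∫⁻ X, avoidProb G x m (X n) ∂(srwLaw G x₀) := by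
  classical
  -- Of the `k + l` steps, the first `k` are explicit indicators and the last `l` are integrated
  -- out. The Markov property moves one step from `k` to `l`.
  have h : ∀ (k l : ℕ), ∫⁻ X, (∏ j ∈ Finset.Ico n (n + k), if X j = x then 0 else 1) *
      avoidProb G x l (X (n + k)) ∂(srwLaw G x₀) =
      ∫⁻ X, avoidProb G x (k + l) (X n) ∂(srwLaw G x₀) := by
    intro k
    induction k with
    | zero => simp
    | succ k ih =>
      intro l
      have := lintegral_srwLaw_succ G x₀ (n + k)
        (F := fun h => ∏ j ∈ (Finset.Ico n (n + k + 1)).attach,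
          if h ⟨j.1, by have := Finset.mem_Ico.1 j.2; exact Finset.mem_Iic.2 (by omega)⟩ = x
            then 0 else 1)
        (Finset.measurable_fun_prod _ fun j _ =>
          (Measurable.of_discrete (f := fun v : V => if v = x then (0 : ℝ≥0∞) else 1)).comp
            (measurable_pi_apply _)) (avoidProb G x l)
      have hF : ∀ X : ℕ → V, (∏ j ∈ (Finset.Ico n (n + k + 1)).attach,
          if Preorder.frestrictLe (π := fun _ => V) (n + k) X
              ⟨j.1, by have := Finset.mem_Ico.1 j.2; exact Finset.mem_Iic.2 (by omega)⟩ = x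
            then (0 : ℝ≥0∞) else 1) = ∏ j ∈ Finset.Ico n (n + k + 1), if X j = x then 0 else 1 :=
        fun X => Finset.prod_attach _ fun j => if X j = x then (0 : ℝ≥0∞) else 1
      simp only [hF] at this
      rw [← add_assoc, this, show k + 1 + l = k + (l + 1) by omega, ← ih (l + 1)]
      refine lintegral_congr fun X => ?_
      rw [Finset.prod_Ico_succ_top (by omega), mul_assoc]
      congr 1
      rw [avoidProb]
      split_ifs <;> simp
  have := h m 0
  rw [add_zero] at this
  rw [← this, ← lintegral_indicator_one]
  · refine lintegral_congr fun X => ?_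
    simp only [avoidProb, mul_one, Set.indicator_apply, Set.mem_ofPred_eq, Pi.one_apply]
    split_ifs with hX
    · refine (Finset.prod_eq_one fun j hj => ?_).symm
      rw [Finset.mem_Ico] at hj
      exact if_neg (hX j hj.1 hj.2)
    · push Not at hX
      obtain ⟨j, h1, h2, h3⟩ := hX
      exact (Finset.prod_eq_zero (f := fun j => if X j = x then (0 : ℝ≥0∞) else 1)
        (Finset.mem_Ico.2 ⟨h1, h2⟩) (if_pos h3)).symm
  · refine measurableSet_setOfPred.2 ?_
    refine Measurable.forall fun j => Measurable.imp (by fun_prop) (Measurable.imp (by fun_prop) ?_)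
    exact (Measurable.of_discrete (f := fun v : V => v ≠ x)).comp (measurable_pi_apply j)

theorem escapeProb_le_one (G : SimpleGraph V) (x y : V) : escapeProb G x y ≤ 1 :=
  (iInf_le _ 0).trans (avoidProb_le_one G x 0 y)

theorem escapeProb_of_ne (G : SimpleGraph V) {x y : V} (hy : y ≠ x) :
    escapeProb G x y = ∫⁻ z, escapeProb G x z ∂(srwStep G y) := by
  have hlim : ∫⁻ z, escapeProb G x z ∂(srwStep G y) = ⨅ m, avoidProb G x (m + 1) y := by
    unfold escapeProb
    rw [lintegral_iInf (fun _ => .of_discrete) (antitone_avoidProb G x)]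
    · simp [avoidProb, hy]
    · exact ne_top_of_le_ne_top (by simp)
        (lintegral_mono (g := fun _ => 1) fun z => avoidProb_le_one G x 0 z)
  rw [hlim]
  refine le_antisymm (le_iInf fun m => iInf_le _ _) (le_iInf fun m => ?_)
  exact (iInf_le _ m).trans (antitone_avoidProb G x m.le_succ y)

theorem lintegral_srwStep {G : SimpleGraph V} {y : V} (S : Finset V)
    (hS : (S : Set V) = G.neighborSet y) (hne : S.Nonempty) (φ : V → ℝ≥0∞) :
    ∫⁻ z, φ z ∂(srwStep G y) = (S.card : ℝ≥0∞)⁻¹ * ∑ z ∈ S, φ z := by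
  rw [srwStep, if_pos, ← hS, lintegral_uniformOn_coe]
  rw [← hS]
  exact ⟨S.finite_toSet, by simpa using hne⟩

/-- For `y ≠ x` this is the first-step equation; the content is `y = x`. The escape probability is
harmonic off `x` and zero at `x`, so `eq_of_adj` makes it constant along edges, and the mean value
property extends to `x`. -/
theorem lintegral_escapeProb {G : SimpleGraph V} (hG : G.HasCutoffs) (x y : V) :
    ∫⁻ z, escapeProb G x z ∂(srwStep G y) = escapeProb G x y := by
  classical
  have hfin : ∀ z, escapeProb G x z ≠ ⊤ := fun z =>
    ne_top_of_le_ne_top ENNReal.one_ne_top (escapeProb_le_one G x z)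
  by_cases hne : (G.neighborSet y).Nonempty
  swap
  · rw [srwStep, if_neg fun h => hne h.2, lintegral_dirac]
  have hconst : ∀ p q, G.Adj p q → escapeProb G x p = escapeProb G x q := by
    intro p q hpq
    refine (ENNReal.toReal_eq_toReal_iff' (hfin p) (hfin q)).1 ?_
    refine hG.eq_of_adj (g := fun z => (escapeProb G x z).toReal) (fun _ => ENNReal.toReal_nonneg)
      (fun z => ENNReal.toReal_le_of_le_ofReal zero_le_one (by simpa using escapeProb_le_one G x z))
      (fun a S hS => ?_) hpq
    by_cases ha : a = x
    · simp [ha, escapeProb_self]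
    · have hT : ((S.filter fun b => G.Adj a b : Finset V) : Set V) = G.neighborSet a := by
        ext b
        simpa using hS b
      rw [← Finset.sum_filter]
      set T := S.filter fun b => G.Adj a b
      rcases T.eq_empty_or_nonempty with h0 | h0
      · simp [h0]
      have h := escapeProb_of_ne G ha
      rw [lintegral_srwStep T hT h0] at h
      have h' := congrArg ENNReal.toReal h
      rw [ENNReal.toReal_mul, ENNReal.toReal_sum fun z _ => hfin z, ENNReal.toReal_inv,
        ENNReal.toReal_natCast] at h'
      have hc : (T.card : ℝ) ≠ 0 := by exact_mod_cast h0.card_pos.ne'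
      rw [Finset.sum_sub_distrib, Finset.sum_const, nsmul_eq_mul]
      have : (T.card : ℝ) * (escapeProb G x a).toReal = ∑ z ∈ T, (escapeProb G x z).toReal := by
        rw [h']; field_simp
      rw [this, sub_self, mul_zero]
  have hS := hG.finite_neighborSet y
  rw [lintegral_srwStep hS.toFinset (by simp) (by simpa using hne),
    Finset.sum_congr rfl fun z hz => (hconst y z (by simpa using hz)).symm, Finset.sum_const,
    nsmul_eq_mul, ← mul_assoc, ENNReal.inv_mul_cancel, one_mul]
  · simpa [Finset.card_eq_zero, ← Set.not_nonempty_iff_eq_empty] using hne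
  · simp

/-- Simple random walk on a graph with cutoffs of arbitrarily small energy is recurrent. -/
theorem SimpleGraph.HasCutoffs.srwRecurrent {G : SimpleGraph V} (hG : G.HasCutoffs) :
    SRWRecurrent G := by
  intro x
  have hmean : ∀ n, ∫⁻ X, escapeProb G x (X n) ∂(srwLaw G x) = 0 := by
    intro n
    induction n with
    | zero =>
      have h0 : ∀ᵐ X ∂(srwLaw G x), X 0 = x := by
        have h := Kernel.traj_map_frestrictLe_apply (X := fun _ => V) (κ := fun n =>
          (srwKernel G).comap (fun h : Finset.Iic n → V => h ⟨n, Finset.mem_Iic.2 le_rfl⟩)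
            (measurable_pi_apply _)) 0 0 (fun _ => x)
        rw [Kernel.partialTraj_self, Kernel.id_apply] at h
        have h' : ∀ᵐ y ∂(Measure.dirac (fun _ : Finset.Iic 0 => x)),
            y ⟨0, Finset.mem_Iic.2 le_rfl⟩ = x := by
          refine (ae_dirac_iff ?_).2 rfl
          exact (MeasurableSet.of_discrete (s := {x})).preimage (measurable_pi_apply _)
        rw [← h] at h'
        exact ae_of_ae_map (Preorder.measurable_frestrictLe 0).aemeasurable h'
      rw [lintegral_congr_ae (g := fun _ => 0), lintegral_zero]
      filter_upwards [h0] with X hX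
      rw [hX, escapeProb_self]
    | succ n ih =>
      have := lintegral_srwLaw_succ G x n (F := fun _ => 1) measurable_const (escapeProb G x)
      simp only [one_mul, lintegral_escapeProb hG] at this
      rw [this, ih]
  -- By the Markov property and monotone limits, this probability is at most the mean of `escapeProb
  -- G x (X n)`.
  have hzero : ∀ n, srwLaw G x {X | ∀ j, n ≤ j → X j ≠ x} = 0 := by
    intro n
    refine le_antisymm ?_ (zero_le)
    have hmeas : ∀ m, Measurable fun X : ℕ → V => avoidProb G x m (X n) := fun m =>
      Measurable.of_discrete.comp (measurable_pi_apply n)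
    calc _ ≤ ⨅ m, ∫⁻ X, avoidProb G x m (X n) ∂(srwLaw G x) :=
          le_iInf fun m => by
            rw [← measure_forall_ne_eq G x x n m]
            refine measure_mono fun X hX => ?_
            rw [Set.mem_ofPred_eq] at hX ⊢
            exact fun j hj _ => hX j hj
      _ = ∫⁻ X, ⨅ m, avoidProb G x m (X n) ∂(srwLaw G x) := by
          rw [lintegral_iInf hmeas fun m m' h X => antitone_avoidProb G x h (X n)]
          exact ne_top_of_le_ne_top (by simp)
            (lintegral_mono (g := fun _ => 1) fun X => avoidProb_le_one G x 0 (X n))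
      _ = 0 := hmean n
  have : ∀ᵐ X ∂(srwLaw G x), ∀ n, ¬ ∀ j, n ≤ j → X j ≠ x := by
    refine ae_all_iff.2 fun n => ?_
    rw [ae_iff]
    simpa using hzero n
  filter_upwards [this] with X hX
  rw [frequently_atTop]
  intro n
  have := hX n
  push Not at this
  exact this

end RecurrenceCriterion

/-! ### The spine and the cutoffs on the decorated tree -/

/-- The function on words that equals `1` off the strict descendants of `s`, and `c j` on the
descendants of the child number `j` of `s`. -/
def descendantValue (s : List ℕ) (c : ℕ → ℝ) : List ℕ → ℝ
  | [] => 1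
  | j :: u => if u = s then c j else descendantValue s c u

theorem descendantValue_of_length_le {s : List ℕ} (c : ℕ → ℝ) {e : List ℕ}
    (h : e.length ≤ s.length) : descendantValue s c e = 1 := by
  induction e with
  | nil => rfl
  | cons j u ih =>
    rw [List.length_cons] at h
    rw [descendantValue, if_neg (by rintro rfl; omega), ih (by omega)]

theorem descendantValue_of_suffix {s : List ℕ} {c : ℕ → ℝ} {j : ℕ} (hj : c j = 0) {e : List ℕ}
    (h : (j :: s) <:+ e) : descendantValue s c e = 0 := by
  induction e with
  | nil => simp at h
  | cons i u ih =>
    rw [descendantValue]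
    split_ifs with hu
    · subst hu
      obtain h | h := List.suffix_cons_iff.1 h
      · rw [← (List.cons.inj h).1, hj]
      · have := h.length_le
        simp at this
    · obtain h | h := List.suffix_cons_iff.1 h
      · exact absurd (List.cons.inj h).2.symm hu
      · exact ih h

theorem List.IsSuffix.eq_or_exists_cons {s u : List ℕ} (h : s <:+ u) :
    u = s ∨ ∃ j, (j :: s) <:+ u := by
  obtain ⟨t, rfl⟩ := h
  induction t using List.reverseRecOn with
  | nil => exact Or.inl rfl
  | append_singleton t j _ => exact Or.inr ⟨j, t, by simp⟩

namespace DecoratedKesten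

variable (ω : List ℕ → Seed)

/-- The special individual of generation `m`. -/
def spine : ℕ → List ℕ
  | 0 => []
  | m + 1 => heir ω (spine m) :: spine m

@[simp]
theorem length_spine (m : ℕ) : (spine ω m).length = m := by
  induction m with
  | zero => rfl
  | succ m ih => simp [spine, ih]

theorem isSpecial_spine (m : ℕ) : IsSpecial ω (spine ω m) := by
  induction m with
  | zero => trivial
  | succ m ih => exact ⟨ih, rfl⟩

theorem spine_suffix {m n : ℕ} (h : m ≤ n) : spine ω m <:+ spine ω n := by
  induction n, h using Nat.le_induction with
  | base => exact List.suffix_rfl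
  | succ n _ ih => exact ih.trans (List.suffix_cons _ _)

variable {ω}

theorem InTree.of_suffix {u v : List ℕ} (hv : InTree ω v) (h : u <:+ v) : InTree ω u := by
  induction v with
  | nil => rwa [List.suffix_nil.1 h]
  | cons j v ih =>
    obtain rfl | h := List.suffix_cons_iff.1 h
    · exact hv
    · exact ih hv.1 h

/-- An individual that is not below `spine (m + 1)` is either not below `spine m`, or equal to it,
or below one of its finitely many children other than the heir. -/
theorem finite_inTree_not_suffix_spine
    (hfin : ∀ u, IsSpecial ω u → ∀ j, j ≠ heir ω u → {v | InTree ω v ∧ (j :: u) <:+ v}.Finite)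
    (m : ℕ) : {v | InTree ω v ∧ ¬ spine ω m <:+ v}.Finite := by
  induction m with
  | zero => simp [spine]
  | succ m ih =>
    have h : (⋃ j ∈ {j | j < numChildren ω (spine ω m) ∧ j ≠ heir ω (spine ω m)},
        {v | InTree ω v ∧ (j :: spine ω m) <:+ v}).Finite :=
      ((Set.finite_lt_nat _).subset fun j hj => hj.1).biUnion fun j hj =>
        hfin _ (isSpecial_spine ω m) j hj.2
    refine ((ih.union h).insert (spine ω m)).subset fun v hv => ?_
    obtain ⟨hv, hv'⟩ := hv
    by_cases hs : spine ω m <:+ v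
    · obtain rfl | ⟨j, hj⟩ := hs.eq_or_exists_cons
      · exact Or.inl rfl
      · refine Or.inr (Or.inr (Set.mem_biUnion (x := j) ⟨(hv.of_suffix hj).2, ?_⟩ ⟨hv, hj⟩))
        rintro rfl
        exact hv' hj
    · exact Or.inr (Or.inl ⟨hv, hs⟩)

variable (ω)

/-- The boundary vertex of `G(u)` that belongs to the edge number `i` of `u`. -/
noncomputable def portAt (u : List ℕ) (i : ℕ) : Fin (graphAt ω u).N :=
  (graphAt ω u).bdry (Fin.ofNat _ i - rotation ω u)

/-- The two vertices of `G(u)` through which the ray of special individuals passes have effective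
resistance at least `1`. -/
def IsResistive (u : List ℕ) : Prop :=
  1 ≤ (graphAt ω u).effRes (portAt ω u 0) (portAt ω u (heir ω u + 1))

variable {ω}

/-- The infimum of the energies is at most 1; the bound 2 leaves room, so that no minimizer is
needed. -/
theorem IsResistive.exists_potential {u : List ℕ} (h : IsResistive ω u) :
    ∃ φ : Fin (graphAt ω u).N → ℝ, φ (portAt ω u 0) = 1 ∧ φ (portAt ω u (heir ω u + 1)) = 0 ∧
      (graphAt ω u).energy φ ≤ 2 := by
  rw [IsResistive, InsertedGraph.effRes, ENNReal.one_le_inv] at h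
  have h' := h.trans_lt ENNReal.one_lt_two
  simp only [iInf_lt_iff] at h'
  obtain ⟨φ, hφ, hE⟩ := h'
  refine ⟨φ, hφ.1, hφ.2, ?_⟩
  by_contra! hlt
  exact hE.not_ge (by simpa using ENNReal.ofReal_le_ofReal hlt.le)

theorem eq_nil_of_attached_nil {x : PreVertex ω} (h : Attached ω x []) : x.1.1 = [] := by
  obtain ⟨i, -, h⟩ := h
  revert h
  refine Fin.cases (fun h => ?_) (fun j h => ?_) (i + rotation ω x.1)
  · exact h
  · exact absurd h (List.cons_ne_nil _ _)

section Cutoff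

variable (φ : ∀ u, Fin (graphAt ω u).N → ℝ) (s : List ℕ)

open Classical in
/-- The potential `φ` on `G(s)`, extended to the other inserted graphs as a function that is
constant on each of them. -/
noncomputable def preCutoff (x : PreVertex ω) : ℝ :=
  if x.1.1 = s then φ x.1 x.2 else descendantValue s (fun j => φ s (portAt ω s (j + 1))) x.1

variable {φ s}

/-- The value at a boundary vertex depends only on the edge matched with it, which makes the
function compatible with the gluing. The normalization `hs` fits `G(s)` to the constant 1 on the
side of its parent. -/
theorem preCutoff_of_attached (hs : φ s (portAt ω s 0) = 1) {x : PreVertex ω} {e : List ℕ}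
    (h : Attached ω x e) :
    preCutoff φ s x = descendantValue s (fun j => φ s (portAt ω s (j + 1))) e := by
  obtain ⟨⟨u, hu⟩, p⟩ := x
  obtain ⟨i, hp, rfl⟩ := h
  change Fin (graphAt ω u).N at p
  change Fin (numChildren ω u + 1) at i
  change (graphAt ω u).bdry i = p at hp
  subst hp
  -- In terms of the edge number `k = i + rotation`, the vertex with label `i` is the port number
  -- `k`.
  have hi : i = i + rotation ω u - rotation ω u := (add_sub_cancel_right _ _).symm
  rw [preCutoff]
  simp only
  generalize hk : i + rotation ω u = k at hi
  split_ifs with hus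
  · subst hus
    rw [hi]
    refine Fin.cases ?_ (fun j => ?_) k
    · rw [edgeAt, Fin.cases_zero, descendantValue_of_length_le _ le_rfl, ← hs]
      rfl
    · rw [edgeAt, Fin.cases_succ, descendantValue, if_pos rfl]
      simp only [portAt]
      congr 3
      ext
      simp [Fin.ofNat, Nat.mod_eq_of_lt]
  · refine Fin.cases ?_ (fun j => ?_) k
    · rfl
    · rw [edgeAt, Fin.cases_succ, descendantValue, if_neg hus]

open Classical in
/-- The function on the vertices of the decorated tree that `preCutoff` induces. -/
noncomputable def cutoff (φ : ∀ u, Fin (graphAt ω u).N → ℝ) (s : List ℕ)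
    (hs : φ s (portAt ω s 0) = 1) : Vertex ω → ℝ
  | none => 1
  | some q => Quotient.lift (preCutoff φ s) (fun x y h => by
      obtain rfl | ⟨e, hx, hy⟩ := h
      · rfl
      · rw [preCutoff_of_attached hs hx, preCutoff_of_attached hs hy]) q

variable {hs : φ s (portAt ω s 0) = 1}

theorem cutoff_mk_of_ne {u : {u : List ℕ // InTree ω u}} (hu : u.1 ≠ s)
    (p : Fin (graphAt ω u).N) :
    cutoff φ s hs (some (Quotient.mk (glue ω) ⟨u, p⟩)) =
      descendantValue s (fun j => φ s (portAt ω s (j + 1))) u :=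
  if_neg hu

theorem cutoff_mk_of_eq {u : {u : List ℕ // InTree ω u}} (hu : u.1 = s)
    (p : Fin (graphAt ω u).N) :
    cutoff φ s hs (some (Quotient.mk (glue ω) ⟨u, p⟩)) = φ u p :=
  if_pos hu

theorem cutoff_mk_of_attached_nil {x : PreVertex ω} (h : Attached ω x []) :
    cutoff φ s hs (some (Quotient.mk (glue ω) x)) = 1 :=
  preCutoff_of_attached hs h

/-- The gradient of the cutoff lives on the edges of `G(s)`, since the cutoff is constant on every
other inserted graph and along the added root edge. -/
theorem EdgeRel.of_cutoff_ne {a b : Vertex ω} (h : EdgeRel ω a b)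
    (hab : cutoff φ s hs a ≠ cutoff φ s hs b) :
    ∃ (u : {u : List ℕ // InTree ω u}) (p q : Fin (graphAt ω u).N), u.1 = s ∧
      (graphAt ω u).graph.Adj p q ∧ a = some (Quotient.mk (glue ω) ⟨u, p⟩) ∧
      b = some (Quotient.mk (glue ω) ⟨u, q⟩) := by
  obtain ⟨u, p, q, h⟩ | ⟨x, h⟩ := h
  · by_cases hu : u.1 = s
    · exact ⟨u, p, q, hu, h, rfl, rfl⟩
    · rw [cutoff_mk_of_ne hu, cutoff_mk_of_ne hu] at hab
      exact absurd rfl hab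
  · rw [cutoff_mk_of_attached_nil h] at hab
    exact absurd rfl hab

theorem adj_of_cutoff_ne {a b : Vertex ω} (h : (tree ω).Adj a b)
    (hab : cutoff φ s hs a ≠ cutoff φ s hs b) :
    ∃ (u : {u : List ℕ // InTree ω u}) (p q : Fin (graphAt ω u).N), u.1 = s ∧
      (graphAt ω u).graph.Adj p q ∧ a = some (Quotient.mk (glue ω) ⟨u, p⟩) ∧
      b = some (Quotient.mk (glue ω) ⟨u, q⟩) := by
  obtain ⟨-, h | h⟩ := (SimpleGraph.fromRel_adj _ _ _).1 h
  · exact h.of_cutoff_ne hab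
  · obtain ⟨u, p, q, hu, hpq, hb, ha⟩ := h.of_cutoff_ne hab.symm
    exact ⟨u, q, p, hu, hpq.symm, ha, hb⟩

/-- Gradients of cutoffs at different individuals have disjoint supports, which is what makes
resistances in series add up. -/
theorem cutoff_eq_of_cutoff_ne {t : List ℕ} {ht : φ t (portAt ω t 0) = 1} (hst : s ≠ t)
    {a b : Vertex ω} (h : (tree ω).Adj a b) (hab : cutoff φ s hs a ≠ cutoff φ s hs b) :
    cutoff φ t ht a = cutoff φ t ht b := by
  obtain ⟨u, p, q, rfl, -, rfl, rfl⟩ := adj_of_cutoff_ne h hab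
  rw [cutoff_mk_of_ne hst, cutoff_mk_of_ne hst]

/-- The factor 2 appears because `energyOn` counts every edge twice, while `energy` carries a factor
`1 / 2`. -/
theorem energyOn_cutoff_le (W : Finset (Vertex ω)) :
    (tree ω).energyOn W (cutoff φ s hs) ≤ 2 * (graphAt ω s).energy (φ s) := by
  classical
  set F : Vertex ω × Vertex ω → ℝ := fun x =>
    if (tree ω).Adj x.1 x.2 then (cutoff φ s hs x.1 - cutoff φ s hs x.2) ^ 2 else 0 with hF
  have hF0 : ∀ x, 0 ≤ F x := fun x => by rw [hF]; simp only; split_ifs <;> positivity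
  have hW : (tree ω).energyOn W (cutoff φ s hs) = ∑ x ∈ W ×ˢ W, F x := by
    rw [SimpleGraph.energyOn, Finset.sum_product]
  have hrhs : 2 * (graphAt ω s).energy (φ s) =
      ∑ x : Fin (graphAt ω s).N × Fin (graphAt ω s).N,
        if (graphAt ω s).graph.Adj x.1 x.2 then (φ s x.1 - φ s x.2) ^ 2 else 0 := by
    rw [InsertedGraph.energy, Fintype.sum_prod_type]
    ring_nf
  rw [hW, hrhs]
  by_cases hsT : InTree ω s
  · set ι : Fin (graphAt ω s).N × Fin (graphAt ω s).N → Vertex ω × Vertex ω := fun x =>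
      (some (Quotient.mk (glue ω) ⟨⟨s, hsT⟩, x.1⟩), some (Quotient.mk (glue ω) ⟨⟨s, hsT⟩, x.2⟩))
      with hι
    set A := (Finset.univ : Finset (Fin (graphAt ω s).N × Fin (graphAt ω s).N)).filter
      fun x => (graphAt ω s).graph.Adj x.1 x.2
    calc ∑ x ∈ W ×ˢ W, F x = ∑ x ∈ W ×ˢ W with F x ≠ 0, F x :=
          (Finset.sum_filter_ne_zero _).symm
      _ ≤ ∑ x ∈ A.image ι, F x := by
          refine Finset.sum_le_sum_of_subset_of_nonneg (fun x hx => ?_) fun x _ _ => hF0 x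
          have hx := (Finset.mem_filter.1 hx).2
          rw [hF] at hx
          simp only [ne_eq, ite_eq_right_iff, Classical.not_imp] at hx
          obtain ⟨⟨u, hu⟩, p, q, rfl, hpq, h1, h2⟩ := adj_of_cutoff_ne hx.1
            (fun h => hx.2 (by rw [h, sub_self, zero_pow two_ne_zero]))
          exact Finset.mem_image.2 ⟨(p, q), by simpa [A] using hpq, Prod.ext h1.symm h2.symm⟩
      -- As an inequality this does not require `ι` to be injective.
      _ ≤ ∑ x ∈ A, F (ι x) := Finset.sum_image_le_of_nonneg fun x _ => hF0 x
      _ ≤ ∑ x ∈ A, (φ s x.1 - φ s x.2) ^ 2 := by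
          refine Finset.sum_le_sum fun x _ => ?_
          rw [hF, hι]
          simp only [cutoff_mk_of_eq (u := ⟨s, hsT⟩) rfl]
          split_ifs
          · exact le_rfl
          · positivity
      _ = _ := Finset.sum_filter _ _
  -- Outside the tree there is no `G(s)` and the cutoff has no gradient. A word of the spine can be
  -- of this kind if a special individual has no children.
  · have : ∀ x ∈ W ×ˢ W, F x = 0 := by
      intro x _
      by_contra hx
      rw [hF] at hx
      simp only [ite_eq_right_iff, Classical.not_imp] at hx
      obtain ⟨⟨u, hu⟩, p, q, rfl, -⟩ := adj_of_cutoff_ne hx.1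
            (fun h => hx.2 (by rw [h, sub_self, zero_pow two_ne_zero]))
      exact hsT hu
    rw [Finset.sum_eq_zero this]
    exact Finset.sum_nonneg fun x _ => by split_ifs <;> positivity

theorem cutoff_mk_of_length_lt {u : {u : List ℕ // InTree ω u}} (hu : u.1.length < s.length)
    (p : Fin (graphAt ω u).N) : cutoff φ s hs (some (Quotient.mk (glue ω) ⟨u, p⟩)) = 1 := by
  rw [cutoff_mk_of_ne (by rintro rfl; exact hu.false), descendantValue_of_length_le _ hu.le]

theorem cutoff_mk_of_suffix (hs' : φ s (portAt ω s (heir ω s + 1)) = 0)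
    {u : {u : List ℕ // InTree ω u}} (hu : (heir ω s :: s) <:+ u.1) (p : Fin (graphAt ω u).N) :
    cutoff φ s hs (some (Quotient.mk (glue ω) ⟨u, p⟩)) = 0 := by
  rw [cutoff_mk_of_ne, descendantValue_of_suffix hs' hu]
  rintro rfl
  have := hu.length_le
  simp at this

end Cutoff

/-- There are no cross terms, because at most one `d i` is nonzero. -/
theorem sq_sum_eq_sum_sq {ι : Type*} (M : Finset ι) (d : ι → ℝ)
    (h : ∀ i ∈ M, d i ≠ 0 → ∀ j ∈ M, j ≠ i → d j = 0) : (∑ i ∈ M, d i) ^ 2 = ∑ i ∈ M, d i ^ 2 := by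
  by_cases h0 : ∀ i ∈ M, d i = 0
  · rw [Finset.sum_eq_zero h0, Finset.sum_eq_zero fun i hi => by rw [h0 i hi, zero_pow two_ne_zero],
      zero_pow two_ne_zero]
  · push Not at h0
    obtain ⟨i, hi, hd⟩ := h0
    rw [Finset.sum_eq_single_of_mem i hi (h i hi hd), Finset.sum_eq_single_of_mem i hi
      fun j hj hji => by rw [h i hi hd j hj hji, zero_pow two_ne_zero]]

/-- If the bushes along the ray of special individuals are finite and infinitely many graphs on
the ray are resistive, then the decorated tree has cutoffs of arbitrarily small energy. -/
theorem hasCutoffs_tree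
    (hfin : ∀ u, IsSpecial ω u → ∀ j, j ≠ heir ω u → {v | InTree ω v ∧ (j :: u) <:+ v}.Finite)
    (hres : ∃ᶠ m in atTop, IsResistive ω (spine ω m)) : (tree ω).HasCutoffs := by
  classical
  intro a₀ b₀ hab₀ ε hε
  have hlevel : ∀ v : Vertex ω, ∃ N, v = none ∨ ∃ (u : {u : List ℕ // InTree ω u})
      (p : Fin (graphAt ω u).N), u.1.length < N ∧ v = some (Quotient.mk (glue ω) ⟨u, p⟩) := by
    rintro (_ | q)
    · exact ⟨0, Or.inl rfl⟩
    · obtain ⟨⟨u, p⟩, rfl⟩ := Quotient.exists_rep q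
      exact ⟨u.1.length + 1, Or.inr ⟨u, p, Nat.lt_succ_self _, rfl⟩⟩
  obtain ⟨Na, ha⟩ := hlevel a₀
  obtain ⟨Nb, hb⟩ := hlevel b₀
  -- Averaging `L` cutoffs of energy at most 4 with disjoint gradients gives energy at most `L * 4 /
  -- L² = 4 / L`.
  obtain ⟨L, hL⟩ := exists_nat_gt (4 / ε)
  have hL0 : (0 : ℝ) < L := lt_trans (by positivity) hL
  -- Only generations beyond both endpoints of the given edge are used, so that every cutoff is 1
  -- there.
  have hinf : {m | IsResistive ω (spine ω m) ∧ max Na Nb ≤ m}.Infinite :=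
    Nat.frequently_atTop_iff_infinite.1 (hres.and_eventually (eventually_ge_atTop _))
  obtain ⟨M, hM, hMcard⟩ := hinf.exists_subset_card_eq L
  have hφ : ∀ u, ∃ φ : Fin (graphAt ω u).N → ℝ, IsResistive ω u → φ (portAt ω u 0) = 1 ∧
      φ (portAt ω u (heir ω u + 1)) = 0 ∧ (graphAt ω u).energy φ ≤ 2 := fun u => by
    by_cases hu : IsResistive ω u
    · obtain ⟨φ, h⟩ := hu.exists_potential
      exact ⟨φ, fun _ => h⟩
    · exact ⟨0, fun h => absurd h hu⟩
  choose φ hφ using hφ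
  set g : ℕ → Vertex ω → ℝ := fun m => if hm : IsResistive ω (spine ω m) then
    cutoff φ (spine ω m) (hφ _ hm).1 else 0 with hg
  have hgM : ∀ m ∈ M, ∃ hm : IsResistive ω (spine ω m),
      g m = cutoff φ (spine ω m) (hφ _ hm).1 := fun m hm =>
    ⟨(hM hm).1, by rw [hg]; exact dif_pos (hM hm).1⟩
  set f : Vertex ω → ℝ := fun v => (L : ℝ)⁻¹ * ∑ m ∈ M, g m v with hf
  -- All chosen cutoffs vanish at and below `spine K`. Positivity of `K` keeps the root out of that
  -- region, which matters for the added root edge.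
  obtain ⟨K, hK0, hK⟩ : ∃ K, 0 < K ∧ ∀ m ∈ M, m < K := ⟨M.sup id + 1, Nat.succ_pos _, fun m hm =>
    Nat.lt_succ_of_le (Finset.le_sup (f := id) hm)⟩
  have hF : {u : {u : List ℕ // InTree ω u} | ¬ spine ω K <:+ u.1}.Finite :=
    Set.Finite.of_finite_image ((finite_inTree_not_suffix_spine hfin K).subset (by
      rintro _ ⟨u, hu, rfl⟩
      exact ⟨u.2, hu⟩)) Subtype.val_injective.injOn
  obtain ⟨W, hWnone, hWmk⟩ : ∃ W : Finset (Vertex ω), none ∈ W ∧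
      ∀ (u : {u : List ℕ // InTree ω u}) (p : Fin (graphAt ω u).N), ¬ spine ω K <:+ u.1 →
        some (Quotient.mk (glue ω) ⟨u, p⟩) ∈ W := by
    have hW := (hF.biUnion fun u _ => Set.finite_range fun p : Fin (graphAt ω u).N =>
      (some (Quotient.mk (glue ω) ⟨u, p⟩) : Vertex ω)).insert none
    exact ⟨hW.toFinset, hW.mem_toFinset.2 (Or.inl rfl), fun u p hu =>
      hW.mem_toFinset.2 (Or.inr (Set.mem_biUnion (x := u) hu ⟨p, rfl⟩))⟩
  have hf0 : ∀ (u : {u : List ℕ // InTree ω u}) (p : Fin (graphAt ω u).N), spine ω K <:+ u.1 →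
      f (some (Quotient.mk (glue ω) ⟨u, p⟩)) = 0 := by
    intro u p hu
    rw [hf]
    simp only
    rw [Finset.sum_eq_zero, mul_zero]
    intro m hm
    obtain ⟨hr, hgm⟩ := hgM m hm
    rw [hgm]
    exact cutoff_mk_of_suffix (hφ _ hr).2.1 ((spine_suffix ω (hK m hm)).trans hu) p
  have hf1 : ∀ (v : Vertex ω) (N : ℕ), N ≤ max Na Nb → (v = none ∨
      ∃ (u : {u : List ℕ // InTree ω u}) (p : Fin (graphAt ω u).N), u.1.length < N ∧
        v = some (Quotient.mk (glue ω) ⟨u, p⟩)) → f v = 1 := by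
    intro v N hN hv
    have : ∀ m ∈ M, g m v = 1 := by
      intro m hm
      obtain ⟨hr, hgm⟩ := hgM m hm
      rw [hgm]
      obtain rfl | ⟨u, p, hu, rfl⟩ := hv
      · rfl
      · exact cutoff_mk_of_length_lt (by rw [length_spine]; have := (hM hm).2; omega) p
    rw [hf]
    simp only
    rw [Finset.sum_congr rfl this, Finset.sum_const, hMcard, nsmul_one, inv_mul_cancel₀ hL0.ne']
  have hedge : ∀ a b, EdgeRel ω a b → (f a ≠ 0 → b ∈ W) ∧ (f b ≠ 0 → a ∈ W) := by
    rintro _ _ (⟨u, p, q, -⟩ | ⟨⟨u, p⟩, hx⟩)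
    · by_cases hu : spine ω K <:+ u.1
      · exact ⟨fun h => absurd (hf0 u p hu) h, fun h => absurd (hf0 u q hu) h⟩
      · exact ⟨fun _ => hWmk u q hu, fun _ => hWmk u p hu⟩
    · refine ⟨fun _ => hWmk u p fun hu => ?_, fun _ => hWnone⟩
      have := hu.length_le
      rw [length_spine, eq_nil_of_attached_nil hx, List.length_nil] at this
      omega
  refine ⟨W, f, fun a b hab hfa => ?_, hf1 a₀ Na (le_max_left _ _) ha,
    hf1 b₀ Nb (le_max_right _ _) hb, ?_⟩
  · obtain ⟨-, h | h⟩ := (SimpleGraph.fromRel_adj _ _ _).1 hab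
    · exact (hedge a b h).1 hfa
    · exact (hedge b a h).2 hfa
  · have hsplit : (tree ω).energyOn W f =
        (L : ℝ)⁻¹ ^ 2 * ∑ m ∈ M, (tree ω).energyOn W (g m) := by
      simp only [SimpleGraph.energyOn]
      rw [Finset.sum_comm (s := M), Finset.mul_sum]
      refine Finset.sum_congr rfl fun a _ => ?_
      rw [Finset.sum_comm (s := M), Finset.mul_sum]
      refine Finset.sum_congr rfl fun b _ => ?_
      by_cases hab : (tree ω).Adj a b
      · simp only [if_pos hab]
        rw [← sq_sum_eq_sum_sq, Finset.sum_sub_distrib, hf]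
        · ring
        · intro m hm hd n hn hnm
          obtain ⟨hr, hgm⟩ := hgM m hm
          obtain ⟨hr', hgn⟩ := hgM n hn
          rw [hgm, sub_ne_zero] at hd
          rw [hgn, sub_eq_zero]
          refine cutoff_eq_of_cutoff_ne (fun h => hnm ?_) hab hd
          simpa using (congrArg List.length h).symm
      · simp only [if_neg hab, Finset.sum_const_zero, mul_zero]
    have hbound : ∀ m ∈ M, (tree ω).energyOn W (g m) ≤ 4 := by
      intro m hm
      obtain ⟨hr, hgm⟩ := hgM m hm
      rw [hgm]
      exact (energyOn_cutoff_le _).trans (by linarith [(hφ _ hr).2.2])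
    calc _ ≤ (L : ℝ)⁻¹ ^ 2 * (L * 4) := by
          rw [hsplit]
          gcongr
          refine (Finset.sum_le_card_nsmul M _ 4 hbound).trans ?_
          rw [hMcard, nsmul_eq_mul]
      _ = 4 / L := by field_simp
      _ ≤ ε := by
          rw [div_lt_iff₀ hε] at hL
          rw [div_le_iff₀ hL0]
          linarith

end DecoratedKesten

/-! ### Independence and relabelling in i.i.d. families -/

section Coordinates

variable {ι X : Type*} [MeasurableSpace X]

/-- The σ-algebra on `ι → X` generated by the coordinates in `S`. -/
@[reducible]
def coordinateSigma (S : Set ι) : MeasurableSpace (ι → X) :=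
  ⨆ i ∈ S, MeasurableSpace.comap (fun ω => ω i) inferInstance

theorem coordinateSigma_mono {S T : Set ι} (h : S ⊆ T) :
    (coordinateSigma S : MeasurableSpace (ι → X)) ≤ coordinateSigma T :=
  biSup_mono h

theorem measurable_apply_coordinateSigma {S : Set ι} {i : ι} (hi : i ∈ S) :
    Measurable[coordinateSigma S] fun ω : ι → X => ω i :=
  (comap_measurable _).mono
    (le_biSup (fun i => MeasurableSpace.comap (fun ω : ι → X => ω i) inferInstance) hi) le_rfl

theorem coordinateSigma_le (S : Set ι) :
    (coordinateSigma S : MeasurableSpace (ι → X)) ≤ MeasurableSpace.pi :=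
  iSup₂_le fun i _ => (measurable_pi_apply i).comap_le

theorem infinitePi_inter_of_disjoint (ν : Measure X) [IsProbabilityMeasure ν] {S T : Set ι}
    (hST : Disjoint S T) {A B : Set (ι → X)} (hA : MeasurableSet[coordinateSigma S] A)
    (hB : MeasurableSet[coordinateSigma T] B) :
    Measure.infinitePi (fun _ : ι => ν) (A ∩ B) =
      Measure.infinitePi (fun _ : ι => ν) A * Measure.infinitePi (fun _ : ι => ν) B := by
  have h : iIndepFun (fun (i : ι) (ω : ι → X) => ω i) (Measure.infinitePi fun _ : ι => ν) :=
    iIndepFun_infinitePi (P := fun _ : ι => ν) (X := fun _ x => x) fun _ => measurable_id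
  exact (Indep_iff _ _ _).1 (indep_iSup_of_disjoint
    (fun i => (measurable_pi_apply i).comap_le) h hST) A B hA hB

/-- With `f w = w ++ v`, this says that the data of the descendants of `v` are distributed as the
whole environment. -/
theorem infinitePi_map_comp_injective {κ : Type*} (ν : Measure X) [IsProbabilityMeasure ν]
    {f : κ → ι} (hf : f.Injective) :
    (Measure.infinitePi fun _ : ι => ν).map (fun ω => fun k => ω (f k)) =
      Measure.infinitePi fun _ : κ => ν := by
  have h : iIndepFun (fun (i : ι) (ω : ι → X) => ω i) (Measure.infinitePi fun _ : ι => ν) :=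
    iIndepFun_infinitePi (P := fun _ : ι => ν) (X := fun _ x => x) fun _ => measurable_id
  rw [(h.precomp hf).map_fun_eq_infinitePi_map fun k => measurable_pi_apply _]
  congr 1
  funext k
  exact Measure.infinitePi_map_eval (fun _ : ι => ν) (f k)

end Coordinates

/-! ### Finiteness of critical Galton–Watson trees -/

section GaltonWatson

/-- Membership in the Galton–Watson tree in which `u` has `η u` children. -/
def InGWTree (η : List ℕ → ℕ) : List ℕ → Prop
  | [] => True
  | j :: u => InGWTree η u ∧ j < η u

/-- Words are written backwards, so the definition recurses at the leaf; this is the branching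
decomposition at the root. -/
theorem inGWTree_append_singleton {η : List ℕ → ℕ} {w : List ℕ} {j : ℕ} :
    InGWTree η (w ++ [j]) ↔ j < η [] ∧ InGWTree (fun v => η (v ++ [j])) w := by
  induction w with
  | nil => simp [InGWTree]
  | cons i w ih =>
    rw [List.cons_append, InGWTree, InGWTree, ih, and_assoc]

theorem finite_inGWTree_iff {η : List ℕ → ℕ} :
    {u | InGWTree η u}.Finite ↔ ∀ j < η [], {w | InGWTree (fun v => η (v ++ [j])) w}.Finite := by
  constructor
  · intro h j hj
    refine Set.Finite.of_finite_image (f := fun w => w ++ [j]) (h.subset ?_)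
      (List.append_left_injective [j]).injOn
    rintro _ ⟨w, hw, rfl⟩
    exact inGWTree_append_singleton.2 ⟨hj, hw⟩
  · intro h
    refine ((((Set.finite_lt_nat (η [])).biUnion fun j hj =>
      (h j hj).image fun w => w ++ [j])).insert []).subset fun u hu => ?_
    rcases u.eq_nil_or_concat with rfl | ⟨w, j, rfl⟩
    · exact Or.inl rfl
    · rw [List.concat_eq_append] at hu ⊢
      obtain ⟨hj, hw⟩ := inGWTree_append_singleton.1 hu
      exact Or.inr (Set.mem_biUnion (x := j) hj ⟨w, hw, rfl⟩)

theorem measurableSet_inGWTree (u : List ℕ) : MeasurableSet {η | InGWTree η u} := by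
  induction u with
  | nil => simp [InGWTree]
  | cons j u ih =>
    exact ih.inter (measurableSet_lt measurable_const (measurable_pi_apply u))

theorem measurableSet_finite_inGWTree : MeasurableSet {η | {u | InGWTree η u}.Finite} := by
  have : {η | {u | InGWTree η u}.Finite} =
      ⋃ S : Finset (List ℕ), ⋂ u ∈ {u | u ∉ S}, {η | InGWTree η u}ᶜ := by
    ext η
    simp only [Set.mem_iUnion, Set.mem_iInter, Set.mem_compl_iff, Set.mem_ofPred_eq]
    constructor
    · intro h
      exact ⟨h.toFinset, fun u hu => by simpa using hu⟩
    · rintro ⟨S, hS⟩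
      exact S.finite_toSet.subset fun u hu => by_contra fun h => hS u h hu
  rw [this]
  exact .iUnion fun S => .biInter (Set.to_countable _) fun u _ => (measurableSet_inGWTree u).compl

/-- Finiteness of the subtree at the child number `j` of the root depends only on the descendants of
that child. -/
theorem measurableSet_finite_inGWTree_shift (j : ℕ) :
    MeasurableSet[coordinateSigma (Set.range fun w : List ℕ => w ++ [j])]
      {η : List ℕ → ℕ | {u | InGWTree (fun v => η (v ++ [j])) u}.Finite} :=
  (@measurable_pi_iff _ _ _ (coordinateSigma (Set.range fun w : List ℕ => w ++ [j])) _
    (fun (η : List ℕ → ℕ) v => η (v ++ [j]))).2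
    (fun w => measurable_apply_coordinateSigma ⟨w, rfl⟩) measurableSet_finite_inGWTree

/-- The number `n` of subtrees is decoupled from `k`, so that induction adds one subtree at a time.
The new subtree reads coordinates disjoint from the earlier ones and has the law of the whole tree.
-/
theorem measure_children_eq_inter (ν : Measure ℕ) [IsProbabilityMeasure ν] (k n : ℕ) :
    Measure.infinitePi (fun _ : List ℕ => ν)
      {η | η [] = k ∧ ∀ j < n, {u | InGWTree (fun v => η (v ++ [j])) u}.Finite} =
      ν {k} * Measure.infinitePi (fun _ : List ℕ => ν) {η | {u | InGWTree η u}.Finite} ^ n := by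
  set P := Measure.infinitePi (fun _ : List ℕ => ν) with hP
  set S : ℕ → Set (List ℕ) := fun n => {u | u = [] ∨ ∃ j < n, ∃ w, u = w ++ [j]} with hS
  have hmeas : ∀ n, MeasurableSet[coordinateSigma (S n)]
      {η : List ℕ → ℕ | η [] = k ∧ ∀ j < n, {u | InGWTree (fun v => η (v ++ [j])) u}.Finite} := by
    intro n
    have h1 : MeasurableSet[coordinateSigma (S n)] {η : List ℕ → ℕ | η [] = k} :=
      measurable_apply_coordinateSigma (i := []) (Or.inl rfl) (measurableSet_singleton k)
    have h2 : MeasurableSet[coordinateSigma (S n)] (⋂ j ∈ {j | j < n},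
        {η : List ℕ → ℕ | {u | InGWTree (fun v => η (v ++ [j])) u}.Finite}) := by
      refine @MeasurableSet.biInter _ _ (coordinateSigma (S n)) _ _ (Set.to_countable _)
        fun j hj => coordinateSigma_mono ?_ _ (measurableSet_finite_inGWTree_shift j)
      rintro _ ⟨w, rfl⟩
      exact Or.inr ⟨j, hj, w, rfl⟩
    convert @MeasurableSet.inter _ (coordinateSigma (S n)) _ _ h1 h2 using 1
    ext η
    simp
  induction n with
  | zero =>
    have : {η : List ℕ → ℕ | η [] = k} = (fun η => η []) ⁻¹' {k} := rfl
    simp only [Nat.not_lt_zero, false_imp_iff, implies_true, and_true, pow_zero, mul_one]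
    rw [this, ← Measure.map_apply (measurable_pi_apply (X := fun _ => ℕ) _) (measurableSet_singleton k), hP,
      Measure.infinitePi_map_eval]
  | succ n ih =>
    have hdisj : Disjoint (S n) (Set.range fun w : List ℕ => w ++ [n]) := by
      rw [Set.disjoint_right]
      rintro _ ⟨w, rfl⟩ (h | ⟨j, hj, w', h⟩)
      · simp at h
      · have := (List.append_inj' h rfl).2
        simp at this
        omega
    have hshift : P {η | {u | InGWTree (fun v => η (v ++ [n])) u}.Finite} =
        P {η | {u | InGWTree η u}.Finite} := by
      conv_rhs => rw [hP, ← infinitePi_map_comp_injective ν (List.append_left_injective [n])]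
      rw [Measure.map_apply (by fun_prop) measurableSet_finite_inGWTree]
      rfl
    rw [pow_succ, ← mul_assoc, ← ih, ← hshift, hP, ← infinitePi_inter_of_disjoint ν hdisj (hmeas n)
      (measurableSet_finite_inGWTree_shift n)]
    congr 1
    ext η
    simp only [Set.mem_inter_iff, Set.mem_ofPred_eq, Nat.lt_succ_iff_lt_or_eq, or_imp, forall_and,
      forall_eq, and_assoc]

theorem measure_finite_inGWTree_eq_tsum (ν : Measure ℕ) [IsProbabilityMeasure ν] :
    Measure.infinitePi (fun _ : List ℕ => ν) {η | {u | InGWTree η u}.Finite} =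
      ∑' k, ν {k} *
        Measure.infinitePi (fun _ : List ℕ => ν) {η | {u | InGWTree η u}.Finite} ^ k := by
  conv_lhs =>
    rw [show {η : List ℕ → ℕ | {u | InGWTree η u}.Finite} = ⋃ k, {η | η [] = k ∧
      ∀ j < k, {u | InGWTree (fun v => η (v ++ [j])) u}.Finite} by
        ext η
        rw [Set.mem_ofPred_eq, finite_inGWTree_iff]
        simp]
  rw [measure_iUnion]
  · simp_rw [measure_children_eq_inter]
  · intro k l hkl
    rw [Function.onFun, Set.disjoint_left]
    rintro η ⟨rfl, -⟩ ⟨h, -⟩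
    exact hkl h
  · intro k
    have h1 : MeasurableSet {η : List ℕ → ℕ | η [] = k} :=
      measurable_pi_apply (X := fun _ => ℕ) _ (measurableSet_singleton k)
    have h2 : MeasurableSet (⋂ j ∈ {j | j < k},
        {η : List ℕ → ℕ | {u | InGWTree (fun v => η (v ++ [j])) u}.Finite}) :=
      MeasurableSet.biInter (Set.to_countable _)
        fun j _ => coordinateSigma_le _ _ (measurableSet_finite_inGWTree_shift j)
    convert h1.inter h2 using 1
    ext η
    simp

/-- A critical probability generating function without affine part has no fixed point in
`[0, 1)`. -/
theorem eq_one_of_pgf_fixed_point (ξ : PMF ℕ) (hξ : ∑' k : ℕ, (k : ℝ≥0∞) * ξ k = 1)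
    (hξ₂ : ∃ k, 2 ≤ k ∧ ξ k ≠ 0) {p : ℝ≥0∞} (hp : p ≤ 1) (h : p = ∑' k, ξ k * p ^ k) : p = 1 := by
  have hp_top : p ≠ ⊤ := ne_top_of_le_ne_top ENNReal.one_ne_top hp
  have toReal : ∀ (a : ℕ → ℝ≥0∞) (s : ℝ≥0∞), s ≠ ⊤ → ∑' k, a k = s →
      HasSum (fun k => (a k).toReal) s.toReal := by
    rintro a s hs rfl
    rw [ENNReal.tsum_toReal_eq fun k => ENNReal.ne_top_of_tsum_ne_top hs k]
    exact ENNReal.hasSum_toReal hs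
  have h0 := toReal _ _ ENNReal.one_ne_top ξ.tsum_coe
  have h1 := toReal _ _ ENNReal.one_ne_top hξ
  have h2 := toReal _ _ hp_top h.symm
  simp only [ENNReal.toReal_mul, ENNReal.toReal_pow, ENNReal.toReal_natCast,
    ENNReal.toReal_one] at h0 h1 h2
  set q := p.toReal
  have hq0 : 0 ≤ q := ENNReal.toReal_nonneg
  have hq1 : q ≤ 1 := ENNReal.toReal_le_of_le_ofReal zero_le_one (by simpa using hp)
  -- Total mass 1, mean 1 and the fixed point equation give `q - 1 - (q - 1) = 0`. By Bernoulli's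
  -- inequality every term is nonnegative, hence zero; for `k ≥ 2` Bernoulli is strict unless `q =
  -- 1`.
  have hsum : HasSum (fun k : ℕ => (ξ k).toReal * (q ^ k - (1 + k * (q - 1)))) 0 := by
    have := (h2.sub h0).sub (h1.mul_right (q - 1))
    rw [one_mul, sub_self] at this
    refine this.congr_fun fun k => ?_
    ring
  have hterm : ∀ k : ℕ, 0 ≤ (ξ k).toReal * (q ^ k - (1 + k * (q - 1))) := fun k => by
    have := one_add_mul_le_pow (show -2 ≤ q - 1 by linarith) k
    rw [add_sub_cancel] at this
    exact mul_nonneg ENNReal.toReal_nonneg (sub_nonneg.2 this)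
  obtain ⟨k, hk, hξk⟩ := hξ₂
  have hz := congrFun ((hasSum_zero_iff_of_nonneg hterm).1 hsum) k
  have hξk' : (ξ k).toReal ≠ 0 := ENNReal.toReal_ne_zero.2 ⟨hξk, ξ.apply_ne_top k⟩
  have hz' := (mul_eq_zero.1 hz).resolve_left hξk'
  have hq : q = 1 := by
    by_contra hne
    have := one_add_mul_self_lt_rpow_one_add (s := q - 1) (by linarith) (sub_ne_zero.2 hne)
      (p := k) (by exact_mod_cast hk)
    rw [add_sub_cancel, Real.rpow_natCast] at this
    linarith
  rw [← ENNReal.ofReal_toReal hp_top]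
  change ENNReal.ofReal q = 1
  rw [hq, ENNReal.ofReal_one]

/-- A critical Galton–Watson tree is finite. -/
theorem ae_finite_inGWTree (ξ : PMF ℕ) (hξ : ∑' k : ℕ, (k : ℝ≥0∞) * ξ k = 1)
    (hξ₂ : ∃ k, 2 ≤ k ∧ ξ k ≠ 0) :
    ∀ᵐ η ∂(Measure.infinitePi fun _ : List ℕ => ξ.toMeasure), {u | InGWTree η u}.Finite := by
  have h := measure_finite_inGWTree_eq_tsum ξ.toMeasure
  simp only [PMF.toMeasure_apply_singleton _ _ (measurableSet_singleton _)] at h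
  exact (mem_ae_iff_prob_eq_one measurableSet_finite_inGWTree).2
    (eq_one_of_pgf_fixed_point ξ hξ hξ₂ prob_le_one h)

end GaltonWatson

/-- This rules out the law concentrated at 1, which is critical but has an infinite tree. -/
theorem exists_two_le_ne_zero_of_tail {α c : ℝ} (hc : 0 < c) {ξ : PMF ℕ}
    (htail : (fun k : ℕ => (ξ k).toReal) ~[atTop] fun k : ℕ => c * (k : ℝ) ^ (-α - 1)) :
    ∃ k, 2 ≤ k ∧ ξ k ≠ 0 := by
  obtain ⟨C, hC⟩ := htail.isBigO_symm.bound
  obtain ⟨k, hk, hk2⟩ := (hC.and (eventually_ge_atTop 2)).exists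
  refine ⟨k, hk2, fun h0 => ?_⟩
  have hpos : 0 < c * (k : ℝ) ^ (-α - 1) :=
    mul_pos hc (Real.rpow_pos_of_pos (by exact_mod_cast (by omega : 0 < k)) _)
  rw [h0, ENNReal.toReal_zero, norm_zero, mul_zero, Real.norm_of_nonneg hpos.le] at hk
  linarith

/-! ### Bushes, seeds along the spine, and resistive graphs -/

namespace DecoratedKesten

section Bushes

variable {ω : List ℕ → Seed} {u : List ℕ} {j : ℕ}

theorem not_isSpecial_append (hj : j ≠ heir ω u) (w : List ℕ) : ¬ IsSpecial ω (w ++ j :: u) := by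
  induction w with
  | nil => exact fun h => hj h.2
  | cons i w ih => exact fun h => ih h.1

/-- Below a child that is not the heir all individuals are normal, so the bush reads only the first
component of the seeds. -/
theorem InTree.inGWTree (hj : j ≠ heir ω u) {w : List ℕ} (hw : InTree ω (w ++ j :: u)) :
    InGWTree (fun w => (ω (w ++ j :: u)).1) w := by
  induction w with
  | nil => trivial
  | cons i w ih =>
    refine ⟨ih hw.1, ?_⟩
    have : i < numChildren ω (w ++ j :: u) := hw.2
    rwa [numChildren, if_neg (not_isSpecial_append hj w)] at this

theorem finite_bush (h : ∀ v, {w | InGWTree (fun w => (ω (w ++ v)).1) w}.Finite)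
    (hj : j ≠ heir ω u) : {v | InTree ω v ∧ (j :: u) <:+ v}.Finite := by
  refine ((h (j :: u)).image fun w => w ++ j :: u).subset ?_
  rintro _ ⟨hv, w, rfl⟩
  exact ⟨w, hv.inGWTree hj, rfl⟩

end Bushes

/-- Every word carries a normal number of children, whether or not it is used. Quantifying over all
countably many words avoids any conditioning on the spine. -/
theorem ae_finite_inGWTree_environment (ξ : PMF ℕ) (hξ : ∑' k : ℕ, (k : ℝ≥0∞) * ξ k = 1)
    (hξ₂ : ∃ k, 2 ≤ k ∧ ξ k ≠ 0)
    (μ : ∀ n, Measure (InsertedGraph n)) [∀ n, IsProbabilityMeasure (μ n)] :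
    ∀ᵐ ω ∂(environmentLaw ξ hξ μ), ∀ v, {w | InGWTree (fun w => (ω (w ++ v)).1) w}.Finite := by
  refine ae_all_iff.2 fun v => ?_
  have hfst : (seedLaw ξ hξ μ).map Prod.fst = ξ.toMeasure := by
    rw [seedLaw, Measure.map_fst_prod, measure_univ, one_smul]
  have hlaw : (environmentLaw ξ hξ μ).map (fun ω w => (ω (w ++ v)).1) =
      Measure.infinitePi fun _ : List ℕ => ξ.toMeasure := by
    have h1 := infinitePi_map_comp_injective (seedLaw ξ hξ μ) (List.append_left_injective v)
    have h2 := Measure.infinitePi_map_pi (fun _ : List ℕ => seedLaw ξ hξ μ)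
      (f := fun _ => Prod.fst) fun _ => measurable_fst
    simp only [hfst] at h2
    rw [← h2, ← h1, Measure.map_map (by fun_prop) (by fun_prop)]
    rfl
  have h := ae_finite_inGWTree ξ hξ hξ₂
  rw [← hlaw] at h
  exact ae_of_ae_map (f := fun (ω : List ℕ → Seed) w => (ω (w ++ v)).1)
    (by fun_prop : Measurable _).aemeasurable h

section Spine

theorem measurable_heirIndex : Measurable fun x : Seed => ((x.2.2.1 (x.2.1 - 1) : Fin _) : ℕ) := by
  refine measurable_to_countable' fun j => ?_
  have : (fun x : Seed => ((x.2.2.1 (x.2.1 - 1) : Fin _) : ℕ)) ⁻¹' {j} =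
      ⋃ k, {x : Seed | x.2.1 = k} ∩ {x | ((x.2.2.1 (k - 1) : Fin _) : ℕ) = j} := by
    ext x
    simp
  rw [this]
  refine .iUnion fun k => .inter ?_ ?_
  · exact (measurable_fst.comp measurable_snd) (measurableSet_singleton k)
  · have h : Measurable fun x : Seed => x.2.2.1 (k - 1) := by fun_prop
    exact (Measurable.of_discrete (f := fun i : Fin (k - 1 + 1) => (i : ℕ))).comp h
      (measurableSet_singleton j)

/-- Each step of the spine reads only the seed at its current position, so generation `m` is reached
without looking at the seeds of that generation. -/
theorem measurableSet_spine_eq (m : ℕ) (u : List ℕ) :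
    MeasurableSet[coordinateSigma {v | v.length < m}] {ω : List ℕ → Seed | spine ω m = u} := by
  induction m generalizing u with
  | zero => simp [spine]
  | succ m ih =>
    rcases u with _ | ⟨j, u⟩
    · simp [spine]
    · by_cases hu : u.length = m
      · have h1 := coordinateSigma_mono (X := Seed) (S := {v : List ℕ | v.length < m})
          (T := {v | v.length < m + 1}) (fun v (hv : v.length < m) => Nat.lt_succ_of_lt hv) _ (ih u)
        have h2 : MeasurableSet[coordinateSigma {v : List ℕ | v.length < m + 1}]
            {ω : List ℕ → Seed | heir ω u = j} :=
          (measurable_heirIndex.comp (measurable_apply_coordinateSigma (i := u)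
            (show u.length < m + 1 by omega))) (measurableSet_singleton j)
        convert @MeasurableSet.inter _ (coordinateSigma _) _ _ h1 h2 using 1
        ext ω
        simp only [spine, Set.mem_ofPred_eq, List.cons.injEq, Set.mem_inter_iff]
        constructor
        · rintro ⟨h, rfl⟩; exact ⟨rfl, h⟩
        · rintro ⟨rfl, h⟩; exact ⟨h, rfl⟩
      · have : {ω : List ℕ → Seed | spine ω (m + 1) = j :: u} = ∅ := by
          ext ω
          simp only [spine, Set.mem_ofPred_eq, List.cons.injEq, Set.mem_empty_iff_false, iff_false]
          rintro ⟨-, rfl⟩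
          exact hu (length_spine ω m)
        rw [this]
        exact @MeasurableSet.empty _ (coordinateSigma _)

/-- The environments in which the data along the special ray lie in `B` in the generations from
`n` to `m - 1`. -/
def spineStays (B : Set Seed) (n m : ℕ) : Set (List ℕ → Seed) :=
  {ω | ∀ i, n ≤ i → i < m → ω (spine ω i) ∈ B}

theorem measurableSet_spineStays {B : Set Seed} (hB : MeasurableSet B) (n m : ℕ) :
    MeasurableSet[coordinateSigma {v : List ℕ | v.length < m}] (spineStays B n m) := by
  have h : ∀ i < m, MeasurableSet[coordinateSigma {v : List ℕ | v.length < m}]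
      {ω : List ℕ → Seed | ω (spine ω i) ∈ B} := by
    intro i hi
    have : {ω : List ℕ → Seed | ω (spine ω i) ∈ B} =
        ⋃ u ∈ {u : List ℕ | u.length = i}, {ω | spine ω i = u} ∩ {ω | ω u ∈ B} := by
      ext ω
      simp only [Set.mem_ofPred_eq, Set.mem_iUnion, Set.mem_inter_iff, exists_prop]
      constructor
      · exact fun h => ⟨_, length_spine ω i, rfl, h⟩
      · rintro ⟨u, -, rfl, h⟩; exact h
    rw [this]
    refine @MeasurableSet.biUnion _ _ (coordinateSigma _) _ _ (Set.to_countable _) fun u hu =>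
      @MeasurableSet.inter _ (coordinateSigma _) _ _ ?_ ?_
    · exact coordinateSigma_mono (X := Seed) (S := {v : List ℕ | v.length < i})
        (T := {v | v.length < m}) (fun v (hv : v.length < i) => hv.trans hi) _
        (measurableSet_spine_eq i u)
    · exact measurable_apply_coordinateSigma (i := u)
        (show u.length < m by rw [show u.length = i from hu]; exact hi) hB
  have : spineStays B n m = ⋂ i ∈ {i | n ≤ i ∧ i < m}, {ω | ω (spine ω i) ∈ B} := by
    ext ω
    simp [spineStays]
  rw [this]
  exact @MeasurableSet.biInter _ _ (coordinateSigma _) _ _ (Set.to_countable _) fun i hi => h i hi.2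

/-- On the event `spine m = u`, the past depends on generations below `m` and is independent of the
seed at `u`, which has law `ν`. Summing over `u` gives the product. -/
theorem measure_spineStays_succ (ν : Measure Seed) [IsProbabilityMeasure ν] {B : Set Seed}
    (hB : MeasurableSet B) {n m : ℕ} (hnm : n ≤ m) :
    Measure.infinitePi (fun _ : List ℕ => ν) (spineStays B n (m + 1)) =
      Measure.infinitePi (fun _ : List ℕ => ν) (spineStays B n m) * ν B := by
  set P := Measure.infinitePi (fun _ : List ℕ => ν) with hP
  have hE := measurableSet_spineStays hB n m
  have hS := measurableSet_spine_eq m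
  have hB' : ∀ u : List ℕ, MeasurableSet[coordinateSigma {u}] {ω : List ℕ → Seed | ω u ∈ B} :=
    fun u => measurable_apply_coordinateSigma (S := {u}) (i := u) (Set.mem_singleton u) hB
  have hEu : ∀ u, MeasurableSet[coordinateSigma {v : List ℕ | v.length < m}]
      (spineStays B n m ∩ {ω | spine ω m = u}) := fun u =>
    @MeasurableSet.inter _ (coordinateSigma _) _ _ hE (hS u)
  have hdisj : Pairwise (Function.onFun Disjoint fun u : List ℕ =>
      spineStays B n m ∩ {ω | spine ω m = u}) := by
    intro u v huv
    rw [Function.onFun, Set.disjoint_left]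
    rintro ω ⟨-, rfl⟩ ⟨-, h⟩
    exact huv h
  have h1 : spineStays B n m = ⋃ u, spineStays B n m ∩ {ω | spine ω m = u} := by
    ext ω
    simp
  have h2 : spineStays B n (m + 1) =
      ⋃ u, (spineStays B n m ∩ {ω | spine ω m = u}) ∩ {ω | ω u ∈ B} := by
    ext ω
    simp only [spineStays, Set.mem_ofPred_eq, Set.mem_iUnion, Set.mem_inter_iff]
    constructor
    · exact fun h => ⟨_, ⟨fun i hi him => h i hi (by omega), rfl⟩, h m hnm (by omega)⟩
    · rintro ⟨_, ⟨h, rfl⟩, h'⟩ i hi him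
      obtain him | rfl := Nat.lt_succ_iff_lt_or_eq.1 him
      · exact h i hi him
      · exact h'
  have hterm : ∀ u, P ((spineStays B n m ∩ {ω | spine ω m = u}) ∩ {ω | ω u ∈ B}) =
      P (spineStays B n m ∩ {ω | spine ω m = u}) * ν B := by
    intro u
    by_cases hu : u.length = m
    · rw [hP, infinitePi_inter_of_disjoint ν (S := {v : List ℕ | v.length < m}) (T := {u}) ?_
        (hEu u) (hB' u)]
      · congr 1
        have := Measure.infinitePi_map_eval (fun _ : List ℕ => ν) u
        conv_rhs => rw [← this, Measure.map_apply (measurable_pi_apply (X := fun _ => Seed) u) hB]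
        rfl
      · rw [Set.disjoint_singleton_right]
        exact fun h => (show u.length < m from h).ne hu
    · have : spineStays B n m ∩ {ω | spine ω m = u} = ∅ := by
        refine Set.eq_empty_of_forall_notMem ?_
        rintro ω ⟨-, rfl⟩
        exact hu (length_spine ω m)
      rw [this]
      simp
  rw [h2, measure_iUnion, tsum_congr hterm, ENNReal.tsum_mul_right, ← measure_iUnion hdisj, ← h1]
  · exact fun u => coordinateSigma_le _ _ (hEu u)
  · exact fun u v huv => (hdisj huv).mono Set.inter_subset_left Set.inter_subset_left
  · exact fun u => (coordinateSigma_le _ _ (hEu u)).inter (coordinateSigma_le _ _ (hB' u))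

/-- Every event of positive probability occurs infinitely often along the special ray. -/
theorem ae_frequently_spine (ν : Measure Seed) [IsProbabilityMeasure ν] {A : Set Seed}
    (hA : MeasurableSet A) (hν : ν A ≠ 0) :
    ∀ᵐ ω ∂(Measure.infinitePi fun _ : List ℕ => ν), ∃ᶠ m in atTop, ω (spine ω m) ∈ A := by
  have hlt : ν Aᶜ < 1 := by
    rw [prob_compl_eq_one_sub hA]
    exact ENNReal.sub_lt_self ENNReal.one_ne_top one_ne_zero hν
  have hpow : ∀ n k, Measure.infinitePi (fun _ : List ℕ => ν) (spineStays Aᶜ n (n + k)) =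
      ν Aᶜ ^ k := by
    intro n k
    induction k with
    | zero =>
      have : spineStays Aᶜ n (n + 0) = Set.univ := by
        refine Set.eq_univ_of_forall fun ω i h1 h2 => ?_
        exact absurd h1 (by omega)
      rw [this, measure_univ, pow_zero]
    | succ k ih =>
      rw [← add_assoc, measure_spineStays_succ ν hA.compl (Nat.le_add_right n k), ih, pow_succ]
  have hzero : ∀ n, ∀ᵐ ω ∂(Measure.infinitePi fun _ : List ℕ => ν),
      ¬ ∀ i, n ≤ i → ω (spine ω i) ∈ Aᶜ := by
    intro n
    rw [ae_iff]
    simp only [not_not]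
    refine le_antisymm (ge_of_tendsto' (ENNReal.tendsto_pow_atTop_nhds_zero_of_lt_one hlt)
      fun k => ?_) zero_le
    rw [← hpow n k]
    refine measure_mono fun ω hω i hi _ => ?_
    exact hω i hi
  filter_upwards [ae_all_iff.2 hzero] with ω hω
  rw [frequently_atTop]
  intro n
  have := hω n
  push Not at this
  simpa using this

end Spine

section Resistance

/-- Effective resistance depends only on the combinatorial part, whose σ-algebra is discrete. -/
theorem measurableSet_one_le_effRes {n : ℕ} (i j : Fin n) :
    MeasurableSet {X : InsertedGraph n | 1 ≤ X.effRes (X.bdry i) (X.bdry j)} := by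
  classical
  let r : (Σ N : ℕ, SimpleGraph (Fin N) × (Fin n ↪ Fin N)) → ℝ≥0∞ := fun s =>
    (⨅ f : Fin s.1 → ℝ, ⨅ _ : f (s.2.2 i) = 1 ∧ f (s.2.2 j) = 0,
      ENNReal.ofReal ((1 / 2) * ∑ p, ∑ q, if s.2.1.Adj p q then (f p - f q) ^ 2 else 0))⁻¹
  have : {X : InsertedGraph n | 1 ≤ X.effRes (X.bdry i) (X.bdry j)} =
      InsertedGraph.shape ⁻¹' {s | 1 ≤ r s} := by
    ext X
    simp only [Set.mem_ofPred_eq, Set.mem_preimage, r, InsertedGraph.effRes, InsertedGraph.energy,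
      InsertedGraph.shape]
  rw [this]
  exact (le_sup_left : MeasurableSpace.comap InsertedGraph.shape ⊤ ≤ _) _ ⟨_, trivial, rfl⟩

/-- Since `n ^ (1 / R) ≥ 1`, the event is covered by finitely many events, one for each pair of
labels. Diagonal pairs have mass zero under `uniformPair`, so some other pair has positive
probability. -/
theorem exists_pair_effRes {n : ℕ} (hn : 2 ≤ n) (μ : Measure (InsertedGraph n))
    [IsProbabilityMeasure μ] {R : ℝ} (hR : 1 ≤ R)
    (h : 0 < (μ.prod (uniformPair n)) {q | ENNReal.ofReal ((n : ℝ) ^ (1 / R)) ≤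
      q.1.effRes (q.1.bdry q.2.1) (q.1.bdry q.2.2)}) :
    ∃ i j : Fin n, i ≠ j ∧ μ {X | 1 ≤ X.effRes (X.bdry i) (X.bdry j)} ≠ 0 := by
  by_contra! hcon
  refine h.ne' (measure_mono_null (t := ⋃ p : Fin n × Fin n,
    {X | 1 ≤ X.effRes (X.bdry p.1) (X.bdry p.2)} ×ˢ {p}) ?_ (measure_iUnion_null fun p => ?_))
  · rintro ⟨X, p⟩ hq
    refine Set.mem_iUnion.2 ⟨p, ?_, rfl⟩
    rw [Set.mem_ofPred_eq] at hq ⊢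
    refine le_trans ?_ hq
    rw [← ENNReal.ofReal_one]
    refine ENNReal.ofReal_le_ofReal (Real.one_le_rpow ?_ (by positivity))
    exact_mod_cast (by omega : 1 ≤ n)
  · have : SFinite (uniformPair n) := by unfold uniformPair; infer_instance
    rw [Measure.prod_prod]
    by_cases hp : p.1 = p.2
    · rw [uniformPair, (uniformOn_eq_zero_iff (Set.toFinite _)).2, mul_zero]
      ext q
      simp only [Set.mem_inter_iff, Set.mem_ofPred_eq, Set.mem_singleton_iff,
        Set.mem_empty_iff_false, iff_false, not_and]
      rintro hq rfl
      exact hq hp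
    · rw [hcon _ _ hp, zero_mul]

theorem uniformOn_univ_singleton_ne_zero {n : ℕ} (i : Fin n) :
    uniformOn (Set.univ : Set (Fin n)) {i} ≠ 0 := by
  rw [Ne, uniformOn_eq_zero_iff Set.finite_univ, Set.univ_inter]
  exact Set.singleton_ne_empty i

theorem infinitePi_eval_preimage {X : ℕ → Type*} [∀ m, MeasurableSpace (X m)]
    (ν : ∀ m, Measure (X m)) [∀ m, IsProbabilityMeasure (ν m)] (k : ℕ) {A : Set (X k)}
    (hA : MeasurableSet A) : Measure.infinitePi ν {f | f k ∈ A} = ν k A := by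
  conv_rhs => rw [← Measure.infinitePi_map_eval ν k, Measure.map_apply (measurable_pi_apply k) hA]
  rfl

/-- The event prescribes `k` children, rotation `-i`, and the heir whose edge has number `j - i`
modulo `k + 1`. Edge `0` then has label `0 - (-i) = i` and the edge to the heir has label `(j - i) -
(-i) = j`. -/
theorem exists_resistive_event (ξ : PMF ℕ) (hξ : ∑' k : ℕ, (k : ℝ≥0∞) * ξ k = 1)
    (μ : ∀ n, Measure (InsertedGraph n)) [∀ n, IsProbabilityMeasure (μ n)] {k : ℕ} (hk : 1 ≤ k)
    (hξk : ξ k ≠ 0) {i j : Fin (k + 1)} (hij : i ≠ j)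
    (h : μ (k + 1) {X | 1 ≤ X.effRes (X.bdry i) (X.bdry j)} ≠ 0) :
    ∃ A : Set Seed, MeasurableSet A ∧ seedLaw ξ hξ μ A ≠ 0 ∧
      ∀ ω u, IsSpecial ω u → ω u ∈ A → IsResistive ω u := by
  have hsub : j - i ≠ 0 := sub_ne_zero.2 hij.symm
  have hval : ((j - i : Fin (k + 1)) : ℕ) ≠ 0 := fun h0 => hsub (Fin.ext h0)
  have hlt : ((j - i : Fin (k + 1)) : ℕ) - 1 < k - 1 + 1 := by
    have := (j - i).isLt
    omega
  set l : Fin (k - 1 + 1) := ⟨((j - i : Fin (k + 1)) : ℕ) - 1, hlt⟩ with hl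
  have hres := measurableSet_one_le_effRes i j
  set B : Set (InsertedGraph (k + 1)) := {X | 1 ≤ X.effRes (X.bdry i) (X.bdry j)} with hB
  refine ⟨Set.univ ×ˢ ({k} ×ˢ ({f | f (k - 1) ∈ ({l} : Set _)} ×ˢ ({f | f k ∈ B} ×ˢ
    {f | f k ∈ ({-i} : Set _)}))), ?_, ?_, ?_⟩
  · refine .prod .univ (.prod (measurableSet_singleton k) (.prod ?_ (.prod ?_ ?_)))
    · exact measurable_pi_apply (X := fun m : ℕ => Fin (m + 1)) _ (measurableSet_singleton l)
    · exact measurable_pi_apply (X := fun m : ℕ => InsertedGraph (m + 1)) _ hres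
    · exact measurable_pi_apply (X := fun m : ℕ => Fin (m + 1)) _ (measurableSet_singleton (-i))
  · have hsb : (sizeBiased ξ hξ).toMeasure {k} ≠ 0 := by
      rw [PMF.toMeasure_apply_singleton _ _ (measurableSet_singleton k)]
      exact mul_ne_zero (by exact_mod_cast (by omega : k ≠ 0)) hξk
    rw [seedLaw, Measure.prod_prod, Measure.prod_prod, Measure.prod_prod, Measure.prod_prod,
      measure_univ, one_mul,
      infinitePi_eval_preimage (fun m : ℕ => uniformOn (Set.univ : Set (Fin (m + 1)))) (k - 1)
        (measurableSet_singleton l),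
      infinitePi_eval_preimage (fun m : ℕ => μ (m + 1)) k hres,
      infinitePi_eval_preimage (fun m : ℕ => uniformOn (Set.univ : Set (Fin (m + 1)))) k
        (measurableSet_singleton (-i))]
    exact mul_ne_zero hsb (mul_ne_zero (uniformOn_univ_singleton_ne_zero l)
      (mul_ne_zero h (uniformOn_univ_singleton_ne_zero (-i))))
  · rintro ω u hu ⟨-, hk', hl', hB', hi'⟩
    have hn : numChildren ω u = k := by rw [numChildren, if_pos hu]; exact hk'
    have hheir : heir ω u + 1 = ((j - i : Fin (k + 1)) : ℕ) := by
      have : heir ω u = l := by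
        rw [heir, show (ω u).2.1 = k from hk', show (ω u).2.2.1 (k - 1) = l from hl']
      rw [this, hl]
      simp only
      omega
    -- The number of children occurs in types, so it is generalized to `n` before being replaced by
    -- `k`.
    have key : ∀ n, n = k → 1 ≤ ((ω u).2.2.2.1 n).effRes
        (((ω u).2.2.2.1 n).bdry (Fin.ofNat (n + 1) 0 - (ω u).2.2.2.2 n))
        (((ω u).2.2.2.1 n).bdry (Fin.ofNat (n + 1) (heir ω u + 1) - (ω u).2.2.2.2 n)) := by
      rintro n rfl
      have h0 : Fin.ofNat (n + 1) 0 - -i = i := by simp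
      have h1 : Fin.ofNat (n + 1) ((j - i : Fin (n + 1)) : ℕ) - -i = j := by simp
      rw [show (ω u).2.2.2.2 n = -i from hi', hheir, h0, h1]
      exact hB'
    exact key _ hn

end Resistance

end DecoratedKesten

theorem theorem1p2
    (α c : ℝ) (hα₁ : 1 < α) (hα₂ : α < 2) (hc : 0 < c)
    (ξ : PMF ℕ) (hξ : ∑' k : ℕ, (k : ℝ≥0∞) * ξ k = 1)
    (htail : (fun k : ℕ => (ξ k).toReal) ~[atTop] fun k : ℕ => c * (k : ℝ) ^ (-α - 1))
    (μ : ∀ n, Measure (InsertedGraph n)) [∀ n, IsProbabilityMeasure (μ n)]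
    (hconn : ∀ n, 1 ≤ n → ∀ᵐ X ∂(μ n), X.graph.Connected)
    (hgrowth : GrowthAssumption α μ) :
    ∀ᵐ ω ∂(environmentLaw ξ hξ μ), SRWRecurrent (DecoratedKesten.tree ω) := by
  have hξ₂ := exists_two_le_ne_zero_of_tail hc htail
  obtain ⟨k, hk, hξk⟩ := id hξ₂
  obtain ⟨R, hR, -, -, hpos, -⟩ := hgrowth.resistance_growth
  -- An individual with `k` children has degree `k + 1`, hence this boundary size.
  have hpos' := hpos.trans_le ((iInf_le _ (k + 1)).trans (iInf_le _ (by omega : 2 ≤ k + 1)))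
  obtain ⟨i, j, hij, hres⟩ :=
    DecoratedKesten.exists_pair_effRes (by omega : 2 ≤ k + 1) (μ (k + 1)) hR hpos'
  obtain ⟨A, hA, hA0, hAres⟩ :=
    DecoratedKesten.exists_resistive_event ξ hξ μ (by omega : 1 ≤ k) hξk hij hres
  filter_upwards [DecoratedKesten.ae_finite_inGWTree_environment ξ hξ hξ₂ μ,
    DecoratedKesten.ae_frequently_spine (seedLaw ξ hξ μ) hA hA0] with ω hfin hfreq
  refine (DecoratedKesten.hasCutoffs_tree (fun u _ j hj => DecoratedKesten.finite_bush hfin hj)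
    (hfreq.mono fun m hm => hAres ω _ (DecoratedKesten.isSpecial_spine ω m) hm)).srwRecurrent
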